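/- **Conventions.** Let $\mathbb{R}^{1,2}$ be $\mathbb{R}^3$ with $\langle x,y\rangle=-x_0y_0+x_1y_1+x_2y_2$, and define $x\boxtimes y$ by $\langle x\boxtimes y,v\rangle=\det(x,y,v)$. Let $\mathbb{D}^2\subset\mathbb{C}$ be the open unit disc, the Klein model of $\mathbb{H}^2$, so that geodesics are chords. With $\Pi(x_0,x_1,x_2)=(x_1/x_0,x_2/x_0)$, the Killing fields of $\mathbb{H}^2$ are $\Lambda(\sigma)(\eta)=d\Pi_{(1,\eta)}\big((1,\eta)\boxtimes\sigma\big)$, $\sigma\in\mathbb{R}^{1,2}$. If $\sigma$ is spacelike, $\Lambda(\sigma)$ is called hyperbolic, with axis $\{\eta\in\mathbb{D}^2:\langle(1,\eta),\sigma\rangle=0\}$. *Width.* A continuous vector field $X$ on $\mathbb{S}^1$ is written $X(z)=iz\,\phi_X(z)$ with $\phi_X:\mathbb{S}^1\to\mathbb{R}$. Let $\mathcal{C}(X)\subset\overline{\mathbb{D}^2}\times\mathbb{R}$ be the convex hull of the graph of $\phi_X$, and let $\partial_-\mathcal{C}(X)$, $\partial_+\mathcal{C}(X)$ be the sets of its lowest,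 respectively highest, points over the points of $\mathbb{D}^2$. The width of $X$ is $$w(X)=\sup\Big\{\tfrac{|t-s|}{\sqrt{1-|\eta|^2}} : (\eta,s)\in\partial_-\mathcal{C}(X),\ (\eta,t)\in\partial_+\mathcal{C}(X)\Big\}\in[0,\infty].$$ *Cross-ratio norm.* $\|X\|_{cr}=\sup|X[Q]|\in[0,\infty]$ over quadruples $Q=[a,b,c,d]$ in $\mathbb{S}^1$ with $\frac{(b-a)(d-c)}{(c-b)(d-a)}=1$, where $$X[Q]=\tfrac{X(b)-X(a)}{b-a}-\tfrac{X(c)-X(b)}{c-b}+\tfrac{X(d)-X(c)}{d-c}-\tfrac{X(a)-X(d)}{a-d}.$$ $X$ is Zygmund if $\|X\|_{cr}<\infty$. *Measured laminations.* A geodesic lamination is a closed set of pairwise disjoint geodesics of $\mathbb{H}^2$, called its leaves. Its gaps are the connected components of the complement of the union of its leaves, and its strata are its leaves and its gaps. A measured geodesic lamination $\lambda$ is a locally finite Borel measure on the space of unoriented geodesics whose support $|\lambda|$ is a geodesic lamination. For an arc $I$, $\lambda(I)$ is the measure of the set of geodesics that meet $I$, and $\|\lambda\|_{\mathrm{Th}}=\sup_I\lambda(I)\in[0,\infty]$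 over the closed geodesic segments $I$ of length $1$ transverse to $|\lambda|$. *Infinitesimal earthquakes.* A left (right) infinitesimal earthquake along a geodesic lamination $\Lambda$ is a (not necessarily continuous) vector field $\mathcal{E}$ on $\mathbb{H}^2$ that agrees on each stratum $S$ with a Killing field $\Lambda(\sigma_S)$, such that for all strata $S,S'$ the Killing field $\mathfrak{a}=\Lambda(\sigma_{S'}-\sigma_S)$ is nonzero unless one of $S,S'$ lies in the closure of the other, and, whenever $\mathfrak{a}$ is nonzero, it is hyperbolic, its axis weakly separates $S$ and $S'$, and it translates to the left (right) seen from $S$ to $S'$. The last condition means: where a geodesic arc from a point of $S$ to a point of $S'$ meets the axis at exactly one point $p$, the direction of the arc and $\mathfrak{a}(p)$ form a positive (negative) basis. $\mathcal{E}$ extends to $X$ if $\mathcal{E}(\eta)\to X(z)$ as $\eta\to z$, $\eta\in\mathbb{D}^2$, for every $z\in\mathbb{S}^1$. *Infinitesimal earthquake measure.* A measured lamination $\lambda$ is *metered* by a set $N$ of pairs $(\eta,v)\in\mathbb{D}^2\times\mathbb{R}^{1,2}$ if, for every geodesic segment $c:[0,1]\to\mathbb{D}^2$ transverse to $|\lambda|$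 with no end point on a leaf of positive measure, $$\lambda(c)=\inf\sum_{i=0}^{n-1}\sqrt{\langle v_{i+1}-v_i,\,v_{i+1}-v_i\rangle},$$ the infimum being over all $0=t_0<\dots<t_n=1$ and $v_0,\dots,v_n$ with $(c(t_i),v_i)\in N$ for all $i$. The infinitesimal earthquake measure of a left (right) infinitesimal earthquake $\mathcal{E}$ along $|\lambda|$ extending to $X$ is described in either of two ways: 1. (bending measure) $\lambda$ is metered by the pairs $(\eta,v)$ for which the plane $\{(\zeta,t):t=\langle(1,\zeta),v\rangle\}$ is a support plane of $\mathcal{C}(X)$ from below (above) at the point of $\partial_-\mathcal{C}(X)$ (of $\partial_+\mathcal{C}(X)$) over $\eta$; 2. (shearing measure) $\lambda$ is metered by the pairs $(\eta,\sigma_S)$ with $\eta$ in the stratum $S$ of $|\lambda|$. **Theorem.** Let $X$ be a continuous vector field on $\mathbb{S}^1$. (a) Let $\lambda$ be a measured geodesic lamination and $\mathcal{E}$ a left or right infinitesimal earthquake along $|\lambda|$ that extends to $X$, such that $\lambda$ is the infinitesimal earthquake measure of $\mathcal{E}$ according to either of the descriptions 1 and 2. Then $$\frac{1-\tanh(1)}{2\sqrt2}\,\|\lambda\|_{\mathrm{Th}}\le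 w(X).$$ (b) $w(X)\le\frac83\,\|X\|_{cr}$. (c) $X$ is Zygmund if and only if $w(X)<\infty$. -/

import Mathlib

open Set Filter Topology MeasureTheory
open scoped ENNReal

noncomputable section

namespace HalfPipe

/-! ### Minkowski space, the Klein disc and Killing fields -/

/-- The underlying space of the Minkowski space `ℝ^{1,2}`, with coordinates `(x₀, x₁, x₂)`. -/
abbrev Mink : Type := Fin 3 → ℝ

/-- The Lorentzian form of signature `(-,+,+)`. -/
def mink (x y : Mink) : ℝ := -(x 0 * y 0) + x 1 * y 1 + x 2 * y 2

/-- The Minkowski cross product `x ⊠ y`. -/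
def box (x y : Mink) : Mink :=
  ![-(x 1 * y 2 - x 2 * y 1), x 2 * y 0 - x 0 * y 2, x 0 * y 1 - x 1 * y 0]

/-- The defining property of the Minkowski cross product. -/
theorem mink_box (x y v : Mink) : mink (box x y) v = (Matrix.of ![x, y, v]).det := by
  simp [mink, box, Matrix.det_fin_three]
  ring

/-- The open unit disc: the Klein model of the hyperbolic plane. -/
def disc : Set ℂ := Metric.ball 0 1

/-- The vector `(1, η)`. -/
def lift (η : ℂ) : Mink := ![1, η.re, η.im]

/-- The radial projection `Π(x₀, x₁, x₂) = (x₁ / x₀, x₂ / x₀)`. -/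
def radialProj (x : Mink) : ℂ := ⟨x 1 / x 0, x 2 / x 0⟩

/-- The Killing field `Λ(σ)` of the hyperbolic plane, written in the Klein model:
`η ↦ dΠ_{(1,η)} ((1,η) ⊠ σ)`. Every Killing field is of this form for a unique `σ`. -/
def killing (σ : Mink) (η : ℂ) : ℂ :=
  ⟨box (lift η) σ 1 - box (lift η) σ 0 * η.re, box (lift η) σ 2 - box (lift η) σ 0 * η.im⟩

/-- `killing σ η` is the image of `(1,η) ⊠ σ` under the differential of `Π` at `(1,η)`. -/
theorem hasDerivAt_radialProj (σ : Mink) (η : ℂ) :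
    HasDerivAt (fun t : ℝ => radialProj (lift η + t • box (lift η) σ)) (killing σ η) 0 := by
  set b := box (lift η) σ with hb
  have lin : ∀ c d : ℝ, HasDerivAt (fun t : ℝ => c + t * d) d 0 := by
    intro c d
    simpa using ((hasDerivAt_id (0 : ℝ)).mul_const d).const_add c
  have q : ∀ c d : ℝ, HasDerivAt (fun t : ℝ => (c + t * d) / (1 + t * b 0)) (d - b 0 * c) 0 := by
    intro c d
    have h := (lin c d).div (lin 1 (b 0)) (by simp)
    have e : (d * (1 + 0 * b 0) - (c + 0 * d) * b 0) / (1 + 0 * b 0) ^ 2 = d - b 0 * c := by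
      simp
      ring
    rw [e] at h
    exact h
  have h := ((q η.re (b 1)).ofReal_comp).add (((q η.im (b 2)).ofReal_comp).mul_const Complex.I)
  have e : ((b 1 - b 0 * η.re : ℝ) : ℂ) + ((b 2 - b 0 * η.im : ℝ) : ℂ) * Complex.I
      = killing σ η := by
    apply Complex.ext <;> simp [killing, ← hb]
  rw [e] at h
  refine h.congr_of_eventuallyEq (Eventually.of_forall fun t => ?_)
  apply Complex.ext <;> simp [radialProj, lift, - Complex.ofReal_div]

/-- Hyperbolic distance in the Klein model: `cosh d = -⟨p, q⟩` for the points `p, q` of the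
hyperboloid which lie over `x, y`. -/
def hypDist (x y : ℂ) : ℝ :=
  Real.arcosh (-mink (lift x) (lift y) / (√(1 - ‖x‖ ^ 2) * √(1 - ‖y‖ ^ 2)))

/-! ### Vector fields on the circle and the width -/

/-- `X` is a vector field on the circle: `X z` is tangent to the circle at `z`. -/
def IsCircleField (X : Circle → ℂ) : Prop :=
  ∀ z : Circle, ∃ t : ℝ, X z = Complex.I * z * t

/-- The support function `φ_X`, determined by `X z = i z φ_X(z)`. -/
def supportFun (X : Circle → ℂ) (z : Circle) : ℝ := (X z / (Complex.I * z)).re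

/-- The convex hull `𝒞(X)`, in the Klein model `𝔻² × ℝ` of (the closure of) half-pipe space, of
the graph of `φ_X`. -/
def hull (X : Circle → ℂ) : Set (ℂ × ℝ) :=
  convexHull ℝ (range fun z : Circle => ((z : ℂ), supportFun X z))

/-- The boundary component `∂₋𝒞(X)`: the lowest points of the hull over the open disc. -/
def lowerBoundary (X : Circle → ℂ) : Set (ℂ × ℝ) :=
  {p | p ∈ hull X ∧ p.1 ∈ disc ∧ ∀ t : ℝ, (p.1, t) ∈ hull X → p.2 ≤ t}

/-- The boundary component `∂₊𝒞(X)`: the highest points of the hull over the open disc. -/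
def upperBoundary (X : Circle → ℂ) : Set (ℂ × ℝ) :=
  {p | p ∈ hull X ∧ p.1 ∈ disc ∧ ∀ t : ℝ, (p.1, t) ∈ hull X → t ≤ p.2}

/-- The height function `L([x, t]) = t / √(-⟨x, x⟩)` at `x = (1, η)`. -/
def height (η : ℂ) (t : ℝ) : ℝ := t / √(-mink (lift η) (lift η))

/-- The width of `X`: the supremum of the distances between points of `∂₋𝒞(X)` and `∂₊𝒞(X)` on a
common fibre. -/
def width (X : Circle → ℂ) : ℝ≥0∞ :=
  ⨆ (η : ℂ) (s : ℝ) (t : ℝ) (_ : (η, s) ∈ lowerBoundary X) (_ : (η, t) ∈ upperBoundary X),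
    ENNReal.ofReal |height η t - height η s|

/-! ### The cross-ratio norm -/

/-- The cross ratio of a quadruple of points. -/
def crossRatio (a b c d : ℂ) : ℂ := ((b - a) * (d - c)) / ((c - b) * (d - a))

/-- The cross-ratio distortion `X[Q]` for `Q = [a, b, c, d]`. -/
def distortion (X : Circle → ℂ) (a b c d : Circle) : ℂ :=
  (X b - X a) / (b - a) - (X c - X b) / (c - b) + (X d - X c) / (d - c) - (X a - X d) / (a - d)

/-- The cross-ratio norm: the supremum of `|X[Q]|` over the quadruples with `cr(Q) = 1` (the four
points of such a quadruple are automatically distinct). -/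
def crossRatioNorm (X : Circle → ℂ) : ℝ≥0∞ :=
  ⨆ (a : Circle) (b : Circle) (c : Circle) (d : Circle) (_ : crossRatio a b c d = 1),
    ENNReal.ofReal ‖distortion X a b c d‖

/-- A continuous vector field on the circle is Zygmund if its cross-ratio norm is finite. -/
def IsZygmund (X : Circle → ℂ) : Prop := Continuous X ∧ crossRatioNorm X < ⊤

/-! ### Geodesics and measured geodesic laminations -/

/-- Two ordered pairs of distinct ideal points are identified if they agree up to order. -/
instance pairSetoid : Setoid {p : Circle × Circle // p.1 ≠ p.2} where
  r p q := p.1 = q.1 ∨ p.1 = q.1.swap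
  iseqv :=
    { refl := fun _ => Or.inl rfl
      symm := by
        rintro p q (h | h)
        · exact Or.inl h.symm
        · exact Or.inr (by rw [h, Prod.swap_swap])
      trans := by
        rintro p q r (h | h) (h' | h')
        · exact Or.inl (h.trans h')
        · exact Or.inr (h.trans h')
        · exact Or.inr (by rw [h, h'])
        · exact Or.inl (by rw [h, h', Prod.swap_swap]) }

/-- The space `𝒢` of unoriented geodesics: unordered pairs of distinct points of the circle. -/
def Geodesic : Type := Quotient pairSetoid

/-- The quotient topology. -/
instance : TopologicalSpace Geodesic := inferInstanceAs (TopologicalSpace (Quotient pairSetoid))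

/-- The Borel σ-algebra. -/
instance : MeasurableSpace Geodesic := borel Geodesic

instance : BorelSpace Geodesic := ⟨rfl⟩

/-- The points of a geodesic: in the Klein model it is the open chord between its end points. -/
def Geodesic.line (g : Geodesic) : Set ℂ :=
  Quotient.lift (s := pairSetoid) (fun p => openSegment ℝ (p.1.1 : ℂ) (p.1.2 : ℂ))
    (by
      rintro p q (h | h)
      · simp only [h]
      · simp only [h, Prod.fst_swap, Prod.snd_swap]
        exact openSegment_symm ℝ _ _) g

/-- A geodesic lamination: a closed set of pairwise disjoint geodesics. -/
def IsGeodesicLamination (Λ : Set Geodesic) : Prop :=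
  IsClosed Λ ∧ Λ.Pairwise fun g h => Disjoint g.line h.line

/-- A measured geodesic lamination: a locally finite Borel measure on the space of geodesics whose
support is a geodesic lamination. -/
def IsMeasuredLamination (μ : Measure Geodesic) : Prop :=
  IsLocallyFiniteMeasure μ ∧ IsGeodesicLamination μ.support

/-- The measure of an arc `I`: the measure of the set of geodesics which intersect `I`. -/
def arcMeasure (μ : Measure Geodesic) (I : Set ℂ) : ℝ≥0∞ := μ {g | (g.line ∩ I).Nonempty}

/-- The geodesic segment from `x` to `y` (a Euclidean segment in the Klein model) is transverse to
the leaves of `Λ`: it has no nontrivial overlap with a leaf. -/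
def IsTransverse (Λ : Set Geodesic) (x y : ℂ) : Prop :=
  ∀ g ∈ Λ, (g.line ∩ segment ℝ x y).Subsingleton

/-- The Thurston norm: the supremum of the measures of the closed geodesic segments of length `1`
which are transverse to the support. -/
def thurstonNorm (μ : Measure Geodesic) : ℝ≥0∞ :=
  ⨆ (x : ℂ) (y : ℂ) (_ : x ∈ disc) (_ : y ∈ disc) (_ : hypDist x y = 1)
    (_ : IsTransverse μ.support x y), arcMeasure μ (segment ℝ x y)

/-! ### Infinitesimal earthquakes -/

/-- The two kinds of infinitesimal earthquakes. -/
inductive Side : Type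
  | left
  | right

/-- The union of the leaves of `Λ`. -/
def leavesUnion (Λ : Set Geodesic) : Set ℂ := ⋃ g ∈ Λ, g.line

/-- The strata of `Λ`: the leaves, and the gaps, which are the connected components of the
complement of the union of the leaves. -/
def IsStratum (Λ : Set Geodesic) (S : Set ℂ) : Prop :=
  (∃ g ∈ Λ, S = g.line) ∨
    ∃ x ∈ disc \ leavesUnion Λ, S = connectedComponentIn (disc \ leavesUnion Λ) x

/-- On `S`, the vector field `E` is the restriction of the Killing field `Λ(σ)`. -/
def AgreesOn (E : ℂ → ℂ) (S : Set ℂ) (σ : Mink) : Prop := ∀ η ∈ S, E η = killing σ η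

/-- The axis of the hyperbolic Killing field `Λ(a)`, for spacelike `a`. -/
def axis (a : Mink) : Set ℂ := {η | η ∈ disc ∧ mink (lift η) a = 0}

/-- The axis of `Λ(a)` weakly separates `S` and `T`: they lie in opposite closed half-planes. -/
def WeaklySeparates (a : Mink) (S T : Set ℂ) : Prop :=
  ((∀ η ∈ S, mink (lift η) a ≤ 0) ∧ ∀ η ∈ T, 0 ≤ mink (lift η) a) ∨
    ((∀ η ∈ S, 0 ≤ mink (lift η) a) ∧ ∀ η ∈ T, mink (lift η) a ≤ 0)

/-- The determinant of a pair of plane vectors; `(v, w)` is a positive basis iff it is positive. -/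
def planeDet (v w : ℂ) : ℝ := v.re * w.im - v.im * w.re

/-- The sign condition in the definition of left and right translations. -/
def Side.HasSign : Side → ℝ → Prop
  | .left, d => 0 < d
  | .right, d => d < 0

/-- `Λ(a)` translates to the left (right), seen from `S` to `T`: whenever a geodesic arc from a
point `x` of `S` to a point `y` of `T` meets the axis at exactly one point `p`, its direction
`y - x` and the direction `Λ(a)(p)` in which `p` is translated along the axis form a positive
(negative) basis. -/
def Translates (s : Side) (a : Mink) (S T : Set ℂ) : Prop :=
  ∀ x ∈ S, ∀ y ∈ T, ∀ p : ℂ, segment ℝ x y ∩ axis a = {p} →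
    s.HasSign (planeDet (y - x) (killing a p))

/-- `E` is a left (right) infinitesimal earthquake along the geodesic lamination `Λ`. Only the
values of `E` in the disc matter. For strata `S, T` on which `E` is the restriction of `Λ(σ)` and
`Λ(τ)`, the comparison field is `Λ(τ) - Λ(σ) = Λ(τ - σ)`. -/
def IsInfEarthquake (s : Side) (Λ : Set Geodesic) (E : ℂ → ℂ) : Prop :=
  IsGeodesicLamination Λ ∧
  (∀ S, IsStratum Λ S → ∃ σ, AgreesOn E S σ) ∧
  ∀ S T, IsStratum Λ S → IsStratum Λ T → ∀ σ τ, AgreesOn E S σ → AgreesOn E T τ →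
    (τ - σ = 0 → S ⊆ closure T ∨ T ⊆ closure S) ∧
    (τ - σ ≠ 0 → 0 < mink (τ - σ) (τ - σ) ∧ WeaklySeparates (τ - σ) S T ∧
      Translates s (τ - σ) S T)

/-- The vector field `E` on the disc extends continuously to the vector field `X` on the circle. -/
def ExtendsTo (E : ℂ → ℂ) (X : Circle → ℂ) : Prop :=
  ∀ z : Circle, Tendsto E (𝓝[disc] (z : ℂ)) (𝓝 (X z))

/-! ### Infinitesimal earthquake measures -/

/-- The normal bundle of `∂₋𝒞(X)` (left) or `∂₊𝒞(X)` (right): the pairs `(x, v)` such that the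
spacelike plane `P_v = {(η, t) | ⟨(1, η), v⟩ = t}` is a support plane at the point over `x`. -/
def normalBundle : Side → (Circle → ℂ) → Set (ℂ × Mink)
  | .left, X => {p | (p.1, mink (lift p.1) p.2) ∈ lowerBoundary X ∧
      ∀ q ∈ hull X, mink (lift q.1) p.2 ≤ q.2}
  | .right, X => {p | (p.1, mink (lift p.1) p.2) ∈ upperBoundary X ∧
      ∀ q ∈ hull X, q.2 ≤ mink (lift q.1) p.2}

/-- The pairs `(x, σ)` such that `E` is the restriction of the Killing field `Λ(σ)` on the stratum
of `Λ` which contains `x`. -/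
def strataFields (Λ : Set Geodesic) (E : ℂ → ℂ) : Set (ℂ × Mink) :=
  {p | ∃ S, IsStratum Λ S ∧ p.1 ∈ S ∧ AgreesOn E S p.2}

/-- The infimum of `∑ θ_i` over the polygonal approximations `(c(t_i), v_i) ∈ N`,
`0 = t_0 < t_1 < ⋯ < t_n = 1`, of the geodesic segment `c` from `x` to `y`. Here
`θ_i = √⟨v_{i+1} - v_i, v_{i+1} - v_i⟩` is the angle between the planes dual to `v_i` and `v_{i+1}`,
which is also the translation length of the Killing field `Λ(v_{i+1} - v_i)`. -/
def polygonalInf (N : Set (ℂ × Mink)) (x y : ℂ) : ℝ≥0∞ :=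
  ⨅ (n : ℕ) (t : Fin (n + 1) → ℝ) (v : Fin (n + 1) → Mink) (_ : StrictMono t) (_ : t 0 = 0)
    (_ : t (Fin.last n) = 1) (_ : ∀ i, (AffineMap.lineMap x y (t i), v i) ∈ N),
    ENNReal.ofReal
      (∑ i : Fin n, √(mink (v i.succ - v i.castSucc) (v i.succ - v i.castSucc)))

/-- `μ` is the measure of which the transverse measure is the infimum over polygonal approximations
in `N`, for every transverse geodesic segment none of whose end points lies on an atomic leaf. (The
infimum ignores atoms at the end points.) -/
def IsMeteredBy (μ : Measure Geodesic) (N : Set (ℂ × Mink)) : Prop :=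
  ∀ x ∈ disc, ∀ y ∈ disc, IsTransverse μ.support x y →
    arcMeasure μ {x} = 0 → arcMeasure μ {y} = 0 →
    arcMeasure μ (segment ℝ x y) = polygonalInf N x y

/-- `μ` is the bending measure of `∂₋𝒞(X)` (left) or `∂₊𝒞(X)` (right). -/
def IsBendingMeasure (s : Side) (X : Circle → ℂ) (μ : Measure Geodesic) : Prop :=
  IsMeteredBy μ (normalBundle s X)

/-- `μ` measures the shearing of the infinitesimal earthquake `E` between its strata. -/
def IsShearingMeasure (E : ℂ → ℂ) (μ : Measure Geodesic) : Prop :=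
  IsMeteredBy μ (strataFields μ.support E)

end HalfPipe

end

noncomputable section

namespace HalfPipe

/-! A vector `σ` gives both a Killing field and the affine function `ζ ↦ ⟨(1,ζ), σ⟩`, which on the
circle is the support function of that field. Everything below compares `φ_X` with affine functions;
a support plane of the hull is an affine function on one side of `φ_X` that meets the hull.

Cross-ratio norm. The diagonals of a harmonic quadruple `Q` meet at a point `p`. There `X[Q]` is `K`
times the difference of the two values obtained by interpolating `φ_X` along the diagonals, and `1 -
‖p‖² = 4 / K²`, so `|X[Q]| ≤ 2 w(X)` (`crossRatioNorm_le`). Conversely, subtract from `φ_X` an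
affine function that supports it from below and touches it at `a` and `c`. Then `X[Q]` is a sum of
two terms of equal sign, which bounds the remainder at `b` by `C |b-a| |b-c| / |a-c|`
(`supportFun_sub_mul_le`). The lowest point of the hull over `η` is a barycentre of contact points.
Averaging the bound over pairs of them gives `w(X) ≤ √2 ‖X‖_cr`, which is more than needed
(`sq_height_le`).

Thurston norm. If `v`, `w` are support planes from below over `x`, `y`, the affine function of `w -
v` is nonpositive at `x` and nonnegative at `y`, so it is not very negative at `x`. Hence it is
large at some ideal point `z`, and the chord from `z` through `x` gives a point of the hull well
above the plane of `v`. This bounds the angle between the planes by the width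
(`ofReal_mul_sqrt_le_width`). The mass of a segment is an infimum over polygons, hence at most the
single angle between support planes at its ends (`mul_thurstonNorm_le_width`).

For the shearing measure, the vectors of the strata are themselves support planes
(`IsInfEarthquake.mem_normalBundle`): the left or right condition orders the affine functions of the
strata, and a limit at the circle compares them with `φ_X`. -/

/-- In finite dimension, the convex hull of a compact set is compact. -/
theorem _root_.IsCompact.isCompact_convexHull_of_finiteDimensional {E : Type*}
    [NormedAddCommGroup E] [NormedSpace ℝ E] [FiniteDimensional ℝ E] {K : Set E}
    (hK : IsCompact K) : IsCompact (convexHull ℝ K) := by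
  -- Carathéodory: at most `dim + 1` points suffice, so the hull is a finite union of continuous
  -- images of compact sets.
  have key : convexHull ℝ K = ⋃ n ∈ Finset.range (Module.finrank ℝ E + 2),
      (fun p : (Fin n → ℝ) × (Fin n → E) => ∑ i, p.1 i • p.2 i) ''
        (stdSimplex ℝ (Fin n) ×ˢ univ.pi fun _ => K) := by
    ext x
    simp only [mem_iUnion, mem_image, Prod.exists, mem_prod, exists_prop, Finset.mem_range]
    constructor
    · intro hx
      obtain ⟨ι, _, z, w, hz, hind, hw, hw1, hx⟩ := eq_pos_convex_span_of_mem_convexHull hx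
      have hcard : Fintype.card ι ≤ Module.finrank ℝ E + 1 :=
        hind.card_le_finrank_succ.trans (by gcongr; exact Submodule.finrank_le _)
      let e := (Fintype.equivFin ι).symm
      refine ⟨Fintype.card ι, by omega, w ∘ e, z ∘ e, ⟨⟨fun i => (hw _).le, ?_⟩, ?_⟩, ?_⟩
      · rw [← hw1]
        exact e.sum_comp w
      · intro i _
        exact hz ⟨_, rfl⟩
      · rw [← hx]
        exact e.sum_comp fun i => w i • z i
    · rintro ⟨n, -, w, z, ⟨⟨hw, hw1⟩, hz⟩, rfl⟩
      exact mem_convexHull_of_exists_fintype w z hw hw1 (fun i => hz i (mem_univ _)) rfl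
  rw [key]
  refine (Finset.range _).isCompact_biUnion fun n _ => ?_
  refine ((isCompact_stdSimplex ℝ (Fin n)).prod (isCompact_univ_pi fun _ => hK)).image ?_
  fun_prop

/-! ### Coordinates -/

theorem mink_lift (η : ℂ) (v : Mink) : mink (lift η) v = -v 0 + η.re * v 1 + η.im * v 2 := by
  simp [mink, lift]

theorem mink_lift_sub (η : ℂ) (v w : Mink) :
    mink (lift η) (v - w) = mink (lift η) v - mink (lift η) w := by
  simp only [mink_lift, Pi.sub_apply]
  ring

theorem mink_lift_neg (η : ℂ) (v : Mink) : mink (lift η) (-v) = -mink (lift η) v := by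
  simp only [mink_lift, Pi.neg_apply]
  ring

theorem mink_lift_self (η : ℂ) : -mink (lift η) (lift η) = 1 - ‖η‖ ^ 2 := by
  rw [← Complex.normSq_eq_norm_sq, Complex.normSq_apply]
  simp [mink, lift]
  ring

theorem mem_disc_iff {η : ℂ} : η ∈ disc ↔ 0 < 1 - ‖η‖ ^ 2 := by
  rw [disc, mem_ball_zero_iff, sub_pos, sq_lt_one_iff₀ (norm_nonneg _)]

theorem norm_sq_eq_re_im (z : ℂ) : ‖z‖ ^ 2 = z.re ^ 2 + z.im ^ 2 := by
  rw [← Complex.normSq_eq_norm_sq, Complex.normSq_apply]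
  ring

theorem mem_disc_iff_re_im {η : ℂ} : η ∈ disc ↔ η.re ^ 2 + η.im ^ 2 < 1 := by
  rw [mem_disc_iff, norm_sq_eq_re_im, sub_pos]

theorem circle_re_im (z : Circle) : (z : ℂ).re ^ 2 + (z : ℂ).im ^ 2 = 1 := by
  rw [← norm_sq_eq_re_im, Circle.norm_coe, one_pow]

theorem convex_disc : Convex ℝ disc := convex_ball _ _

theorem isOpen_disc : IsOpen disc := Metric.isOpen_ball

theorem mink_lift_affine (ι : Type*) [Fintype ι] (w : ι → ℝ) (z : ι → ℂ) (hw : ∑ i, w i = 1)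
    (v : Mink) : mink (lift (∑ i, w i • z i)) v = ∑ i, w i * mink (lift (z i)) v := by
  simp only [mink_lift, Complex.re_sum, Complex.im_sum, Complex.real_smul, Complex.re_ofReal_mul,
    Complex.im_ofReal_mul, mul_add, Finset.sum_add_distrib, ← Finset.sum_mul, ← mul_assoc, hw]
  ring

theorem mink_lift_combo {a b : ℝ} (hab : a + b = 1) (x y : ℂ) (v : Mink) :
    mink (lift (a • x + b • y)) v = a * mink (lift x) v + b * mink (lift y) v := by
  obtain rfl : a = 1 - b := by linarith
  simp [mink_lift]
  ring

@[fun_prop]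
theorem continuous_mink_lift (v : Mink) : Continuous fun η : ℂ => mink (lift η) v := by
  simp only [mink_lift]
  fun_prop

theorem exists_circle {c d : ℝ} (h : c ^ 2 + d ^ 2 = 1) :
    ∃ z : Circle, (z : ℂ).re = c ∧ (z : ℂ).im = d := by
  refine ⟨⟨⟨c, d⟩, mem_sphere_zero_iff_norm.2 ?_⟩, rfl, rfl⟩
  rw [← sq_eq_sq₀ (norm_nonneg _) zero_le_one, norm_sq_eq_re_im, one_pow, h]

/-- The chord through the point `x` of the disc with end point `z`. -/
theorem exists_chord {x : ℂ} (hx : x ∈ disc) (z : Circle) :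
    ∃ (z' : Circle) (α β : ℝ), 0 < α ∧ 0 < β ∧ α + β = 1 ∧ α • (z : ℂ) + β • (z' : ℂ) = x ∧
      2 * α * (1 - (x.re * (z : ℂ).re + x.im * (z : ℂ).im)) = 1 - ‖x‖ ^ 2 := by
  have hx' := mem_disc_iff_re_im.1 hx
  rw [norm_sq_eq_re_im]
  have hz := circle_re_im z
  set a := x.re with ha
  set b := x.im with hb
  set c := (z : ℂ).re with hc
  set d := (z : ℂ).im with hd
  set h := 1 - (a * c + b * d) with hh
  have hh0 : 0 < h := by nlinarith [sq_nonneg (a - c), sq_nonneg (b - d)]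
  have hsum : (a - c) ^ 2 + (b - d) ^ 2 = 2 * h - (1 - (a ^ 2 + b ^ 2)) := by
    rw [hh]
    linear_combination hz
  have hne : 0 < (a - c) ^ 2 + (b - d) ^ 2 := by
    rw [hsum]
    have e : 1 - (a ^ 2 + b ^ 2) = (1 - (a * c + b * d)) * (1 + (a * c + b * d))
        - (a * d - b * c) ^ 2 := by linear_combination (a ^ 2 + b ^ 2) * hz
    nlinarith [sq_nonneg (a * d - b * c), sq_nonneg (1 - (a * c + b * d))]
  -- The value of `α` is forced: `z' = (x - α z) / (1 - α)` has norm one exactly when `2 α (1 - x·z)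
  -- = 1 - ‖x‖²`.
  set α := (1 - (a ^ 2 + b ^ 2)) / (2 * h) with hα
  set β := ((a - c) ^ 2 + (b - d) ^ 2) / (2 * h) with hβ
  have hα0 : 0 < α := div_pos (by linarith) (by linarith)
  have hβ0 : 0 < β := div_pos hne (by linarith)
  have hαβ : α + β = 1 := by
    rw [hα, hβ, hsum]
    field_simp
    ring
  have hαh : 2 * α * h = 1 - (a ^ 2 + b ^ 2) := by
    rw [hα]
    field_simp
  clear_value α β
  obtain ⟨z', h1, h2⟩ := exists_circle (c := (a - α * c) / β) (d := (b - α * d) / β) (by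
    rw [div_pow, div_pow, ← add_div, div_eq_one_iff_eq (by positivity)]
    rw [show β = 1 - α by linarith]
    rw [hh] at hαh
    linear_combination α ^ 2 * hz + hαh)
  refine ⟨z', α, β, hα0, hβ0, hαβ, ?_, hαh⟩
  apply Complex.ext
  · simp only [Complex.add_re, Complex.smul_re, smul_eq_mul, h1]
    field_simp
    ring
  · simp only [Complex.add_im, Complex.smul_im, smul_eq_mul, h2]
    field_simp
    ring

/-! ### The convex hull of the graph -/

theorem continuous_supportFun {X : Circle → ℂ} (hXc : Continuous X) :
    Continuous (supportFun X) := by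
  unfold supportFun
  refine Complex.continuous_re.comp (hXc.div (by fun_prop) fun z => ?_)
  exact mul_ne_zero Complex.I_ne_zero z.coe_ne_zero

theorem eq_supportFun {X : Circle → ℂ} (hX : IsCircleField X) (z : Circle) :
    X z = Complex.I * z * supportFun X z := by
  obtain ⟨t, ht⟩ := hX z
  have h : (Complex.I * z : ℂ) ≠ 0 := mul_ne_zero Complex.I_ne_zero z.coe_ne_zero
  rw [supportFun, ht, mul_div_cancel_left₀ _ h, Complex.ofReal_re]

theorem graph_mem_hull (X : Circle → ℂ) (z : Circle) : ((z : ℂ), supportFun X z) ∈ hull X :=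
  subset_convexHull ℝ _ ⟨z, rfl⟩

theorem chord_mem_hull (X : Circle → ℂ) (z z' : Circle) {α β : ℝ} (hα : 0 ≤ α) (hβ : 0 ≤ β)
    (hαβ : α + β = 1) :
    (α • (z : ℂ) + β • (z' : ℂ), α * supportFun X z + β * supportFun X z') ∈ hull X :=
  convex_convexHull ℝ _ (graph_mem_hull X z) (graph_mem_hull X z') hα hβ hαβ

theorem isCompact_hull {X : Circle → ℂ} (hXc : Continuous X) : IsCompact (hull X) :=
  (isCompact_range (f := fun z : Circle => ((z : ℂ), supportFun X z))
    ((by fun_prop : Continuous fun z : Circle => (z : ℂ)).prodMk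
      (continuous_supportFun hXc))).isCompact_convexHull_of_finiteDimensional

theorem mem_hull_iff {X : Circle → ℂ} {p : ℂ × ℝ} :
    p ∈ hull X ↔ ∃ (ι : Type) (_ : Fintype ι) (w : ι → ℝ) (z : ι → Circle), (∀ i, 0 ≤ w i) ∧
      ∑ i, w i = 1 ∧ ∑ i, w i • (z i : ℂ) = p.1 ∧ ∑ i, w i * supportFun X (z i) = p.2 := by
  rw [hull]
  constructor
  · intro hp
    obtain ⟨ι, _, w, y, hw, hw1, hy, rfl⟩ := mem_convexHull_iff_exists_fintype.1 hp
    choose z hz using hy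
    simp only [← hz]
    exact ⟨ι, _, w, z, hw, hw1, by simp [Prod.fst_sum], by simp [Prod.snd_sum]⟩
  · rintro ⟨ι, _, w, z, hw, hw1, h1, h2⟩
    refine mem_convexHull_of_exists_fintype w (fun i => ((z i : ℂ), supportFun X (z i))) hw hw1
      (fun i => ⟨z i, rfl⟩) (Prod.ext ?_ ?_)
    · simpa [Prod.fst_sum] using h1
    · simpa [Prod.snd_sum] using h2

/-- An affine function which is at most `φ_X` on the circle lies below the hull. -/
theorem mink_le_of_mem_hull {X : Circle → ℂ} {v : Mink}
    (hv : ∀ z : Circle, mink (lift z) v ≤ supportFun X z) {q : ℂ × ℝ} (hq : q ∈ hull X) :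
    mink (lift q.1) v ≤ q.2 := by
  obtain ⟨ι, _, w, z, hw, hw1, h1, h2⟩ := mem_hull_iff.1 hq
  rw [← h1, ← h2, mink_lift_affine ι w _ hw1]
  exact Finset.sum_le_sum fun i _ => mul_le_mul_of_nonneg_left (hv _) (hw i)

/-- An affine function which is at least `φ_X` on the circle lies above the hull. -/
theorem le_mink_of_mem_hull {X : Circle → ℂ} {v : Mink}
    (hv : ∀ z : Circle, supportFun X z ≤ mink (lift z) v) {q : ℂ × ℝ} (hq : q ∈ hull X) :
    q.2 ≤ mink (lift q.1) v := by
  obtain ⟨ι, _, w, z, hw, hw1, h1, h2⟩ := mem_hull_iff.1 hq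
  rw [← h1, ← h2, mink_lift_affine ι w _ hw1]
  exact Finset.sum_le_sum fun i _ => mul_le_mul_of_nonneg_left (hv _) (hw i)

theorem supportFun_neg (X : Circle → ℂ) (z : Circle) : supportFun (-X) z = -supportFun X z := by
  simp [supportFun, neg_div]

theorem mem_hull_neg {X : Circle → ℂ} {η : ℂ} {t : ℝ} : (η, t) ∈ hull (-X) ↔ (η, -t) ∈ hull X := by
  simp only [mem_hull_iff, supportFun_neg, mul_neg, Finset.sum_neg_distrib, neg_eq_iff_eq_neg]

theorem width_neg (X : Circle → ℂ) : width (-X) ≤ width X := by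
  refine iSup_le fun η => iSup_le fun s => iSup_le fun t => iSup_le fun hs => iSup_le fun ht => ?_
  have hs' : (η, -s) ∈ upperBoundary X :=
    ⟨mem_hull_neg.1 hs.1, hs.2.1, fun u hu => by
      have := hs.2.2 (-u) (mem_hull_neg.2 (by simpa using hu))
      simp only at this ⊢
      linarith⟩
  have ht' : (η, -t) ∈ lowerBoundary X :=
    ⟨mem_hull_neg.1 ht.1, ht.2.1, fun u hu => by
      have := ht.2.2 (-u) (mem_hull_neg.2 (by simpa using hu))
      simp only at this ⊢
      linarith⟩
  refine le_trans (le_of_eq ?_) (le_iSup_of_le η <| le_iSup_of_le (-t) <| le_iSup_of_le (-s) <|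
    le_iSup_of_le ht' <| le_iSup_of_le hs' le_rfl)
  congr 2
  simp only [height]
  ring

/-- The distance of two points of the hull on a common fibre is at most the width. -/
theorem ofReal_sub_div_le_width {X : Circle → ℂ} (hXc : Continuous X) {η : ℂ} (hη : η ∈ disc)
    {s t : ℝ} (hs : (η, s) ∈ hull X) (ht : (η, t) ∈ hull X) :
    ENNReal.ofReal ((t - s) / √(1 - ‖η‖ ^ 2)) ≤ width X := by
  have hc : IsCompact {u : ℝ | (η, u) ∈ hull X} := by
    have := (isCompact_hull hXc).inter_right (t := {p : ℂ × ℝ | p.1 = η})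
      (isClosed_eq continuous_fst continuous_const)
    convert this.image continuous_snd using 1
    ext u
    simp
  obtain ⟨a, ha, ha'⟩ := hc.exists_isLeast ⟨s, hs⟩
  obtain ⟨b, hb, hb'⟩ := hc.exists_isGreatest ⟨s, hs⟩
  refine le_trans (ENNReal.ofReal_le_ofReal ?_) (le_iSup_of_le η <| le_iSup_of_le a <|
    le_iSup_of_le b <| le_iSup_of_le ⟨ha, hη, fun u hu => ha' hu⟩ <|
    le_iSup_of_le ⟨hb, hη, fun u hu => hb' hu⟩ le_rfl)
  have h1 := ha' hs
  have h2 := hb' ht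
  rw [height, height, ← sub_div, mink_lift_self, abs_div, abs_of_nonneg (Real.sqrt_nonneg _)]
  exact div_le_div_of_nonneg_right (by linarith [le_abs_self (b - a)]) (Real.sqrt_nonneg _)

/-- Through every point of the open disc there passes a support plane of the hull from below. -/
theorem exists_support {X : Circle → ℂ} (hXc : Continuous X) {η : ℂ} (hη : η ∈ disc) :
    ∃ v : Mink, (∀ z : Circle, mink (lift z) v ≤ supportFun X z) ∧
      (η, mink (lift η) v) ∈ hull X := by
  obtain ⟨M, hM⟩ := (isCompact_range (continuous_supportFun hXc)).bddAbove
  replace hM : ∀ z, supportFun X z ≤ M := fun z => hM ⟨z, rfl⟩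
  have hfib : ∀ ζ ∈ disc, ∃ t, (ζ, t) ∈ hull X ∧ t ≤ M := by
    intro ζ hζ
    obtain ⟨z', α, β, hα, hβ, hαβ, e, -⟩ := exists_chord hζ 1
    refine ⟨_, e ▸ chord_mem_hull X 1 z' hα.le hβ.le hαβ, ?_⟩
    calc α * supportFun X 1 + β * supportFun X z' ≤ α * M + β * M := by gcongr <;> exact hM _
      _ = M := by rw [← add_mul, hαβ, one_mul]
  have hc : IsCompact {u : ℝ | (η, u) ∈ hull X} := by
    have := (isCompact_hull hXc).inter_right (t := {p : ℂ × ℝ | p.1 = η})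
      (isClosed_eq continuous_fst continuous_const)
    convert this.image continuous_snd using 1
    ext u
    simp
  obtain ⟨t₀, ht₀, -⟩ := hfib η hη
  obtain ⟨s, hs, hs'⟩ := hc.exists_isLeast ⟨t₀, ht₀⟩
  -- The epigraph of the lower boundary, unlike the hull itself, always has interior points, namely
  -- those above the bound `M`. The lowest point over `η` is not interior, so it can be separated
  -- from the interior.
  set A : Set (ℂ × ℝ) := {p | ∃ t, (p.1, t) ∈ hull X ∧ t ≤ p.2} with hA
  have hAc : Convex ℝ A := by
    rintro p ⟨t, ht, htp⟩ q ⟨u, hu, huq⟩ a b ha hb hab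
    refine ⟨a * t + b * u, convex_convexHull ℝ _ ht hu ha hb hab, ?_⟩
    simp only [Prod.snd_add, Prod.smul_snd, smul_eq_mul]
    gcongr
  have hopen : disc ×ˢ Ioi M ⊆ interior A := by
    refine interior_maximal ?_ (isOpen_disc.prod isOpen_Ioi)
    rintro p ⟨h1, h2⟩
    obtain ⟨t, ht, htM⟩ := hfib _ h1
    exact ⟨t, ht, htM.trans h2.le⟩
  have hnot : (η, s) ∉ interior A := by
    intro h
    have hcont : Tendsto (fun δ : ℝ => (η, s - δ)) (𝓝[>] 0) (𝓝 (η, s)) := by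
      have : Continuous fun δ : ℝ => (η, s - δ) := by fun_prop
      simpa using (this.tendsto 0).mono_left nhdsWithin_le_nhds
    obtain ⟨δ, ⟨t, ht, hts⟩, hδ⟩ :=
      ((hcont.eventually (mem_interior_iff_mem_nhds.1 h)).and self_mem_nhdsWithin).exists
    have := hs' ht
    simp only at hts
    linarith
  obtain ⟨f, hf⟩ := geometric_hahn_banach_open_point hAc.interior isOpen_interior hnot
  have hfdec : ∀ (ζ : ℂ) (t : ℝ),
      f (ζ, t) = ζ.re * f (1, 0) + ζ.im * f (Complex.I, 0) + t * f (0, 1) := by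
    intro ζ t
    have : ((ζ, t) : ℂ × ℝ) = ζ.re • ((1 : ℂ), (0 : ℝ)) + ζ.im • ((Complex.I : ℂ), (0 : ℝ))
        + t • ((0 : ℂ), (1 : ℝ)) := by
      ext <;> simp
    rw [this, map_add, map_add, map_smul, map_smul, map_smul, smul_eq_mul, smul_eq_mul,
      smul_eq_mul]
  have hfA : ∀ p ∈ A, f p ≤ f (η, s) := by
    intro p hp
    have hcl : p ∈ closure (interior A) := by
      rw [hAc.closure_interior_eq_closure_of_nonempty_interior
        ⟨(η, M + 1), hopen ⟨hη, by simp⟩⟩]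
      exact subset_closure hp
    exact closure_minimal (fun q hq => (hf q hq).le)
      (isClosed_le f.continuous continuous_const) hcl
  set c := f (0, 1) with hc0
  -- The separating plane is not vertical, because the interior contains a point straight above `(η,
  -- s)`. Solving `f (ζ, t) = f (η, s)` for `t` then gives the affine function.
  have hcneg : c < 0 := by
    have h1 := hf (η, max M s + 1) (hopen ⟨hη, by simp [lt_add_of_le_of_pos]⟩)
    rw [hfdec, hfdec η s] at h1
    have : s < max M s + 1 := by linarith [le_max_right M s]
    nlinarith
  refine ⟨![-(f (η, s) / c), -(f (1, 0) / c), -(f (Complex.I, 0) / c)], fun z => ?_, ?_⟩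
  · have h1 := hfA (z, supportFun X z) ⟨_, graph_mem_hull X z, le_rfl⟩
    rw [hfdec] at h1
    simp only [mink_lift, Matrix.cons_val_zero, Matrix.cons_val_one, Matrix.cons_val]
    rw [show ∀ a b x y : ℝ, - -(f (η, s) / c) + a * -(x / c) + b * -(y / c)
      = (f (η, s) - a * x - b * y) / c by intros; field_simp; ring, div_le_iff_of_neg hcneg]
    linarith
  · have hval : mink (lift η) ![-(f (η, s) / c), -(f (1, 0) / c), -(f (Complex.I, 0) / c)] = s := by
      simp only [mink_lift, Matrix.cons_val_zero, Matrix.cons_val_one, Matrix.cons_val]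
      rw [hfdec]
      field_simp [hcneg.ne]
      ring
    rw [hval]
    exact hs

/-! ### Harmonic quadruples -/

theorem conj_circle (z : Circle) : (starRingEnd ℂ) (z : ℂ) = (z : ℂ)⁻¹ := by
  rw [← Circle.coe_inv_eq_conj, Circle.coe_inv]

/-- The coefficient of `φ_X(b)` in the cross-ratio distortion of a quadruple `[a, b, c, d]`. -/
def vertexCoeff (a b c : ℂ) : ℂ := Complex.I * b * (c - a) / ((b - a) * (c - b))

/-- On the circle conjugation is inversion, and `u⁻¹ - v⁻¹ = -(u - v) u⁻¹ v⁻¹`. The monomials so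
produced cancel, and the one leftover sign cancels that of the conjugate of `I`. -/
theorem exists_real_vertexCoeff (a b c : Circle) : ∃ r : ℝ, (r : ℂ) = vertexCoeff a b c := by
  refine Complex.conj_eq_iff_real.1 ?_ |>.imp fun _ h => h.symm
  simp only [vertexCoeff, map_div₀, map_mul, map_sub, conj_circle, Complex.conj_I]
  have ha := a.coe_ne_zero
  have hb := b.coe_ne_zero
  have hc := c.coe_ne_zero
  have e : ∀ u v : Circle, (u : ℂ)⁻¹ - (v : ℂ)⁻¹ = -((u - v : ℂ) * ((u : ℂ)⁻¹ * (v : ℂ)⁻¹)) := by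
    intro u v
    have := u.coe_ne_zero
    have := v.coe_ne_zero
    field_simp
    ring
  rw [e, e, e]
  rw [show ((-((b - a : ℂ) * ((b : ℂ)⁻¹ * (a : ℂ)⁻¹))) *
      (-((c - b : ℂ) * ((c : ℂ)⁻¹ * (b : ℂ)⁻¹)))) =
    ((b - a) * (c - b)) * ((b : ℂ)⁻¹ * (b : ℂ)⁻¹ * (a : ℂ)⁻¹ * (c : ℂ)⁻¹) by ring]
  rw [div_mul_eq_div_div, div_right_comm]
  congr 1
  field_simp

theorem norm_sub_sq_circle (a c : Circle) :
    ((‖(a - c : ℂ)‖ ^ 2 : ℝ) : ℂ) = -(a - c : ℂ) ^ 2 / (a * c) := by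
  have ha := a.coe_ne_zero
  have hc := c.coe_ne_zero
  rw [Complex.ofReal_pow, ← Complex.mul_conj', map_sub, conj_circle, conj_circle]
  field_simp
  ring

theorem ne_of_crossRatio_eq_one {a b c d : ℂ} (h : crossRatio a b c d = 1) :
    b - a ≠ 0 ∧ c - b ≠ 0 ∧ d - c ≠ 0 ∧ d - a ≠ 0 ∧ c - a ≠ 0 ∧ d - b ≠ 0 ∧
      (b - a) * (d - c) = (c - b) * (d - a) := by
  unfold crossRatio at h
  -- Division by zero gives `0 ≠ 1`, so cross ratio one already excludes degenerate quadruples. The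
  -- diagonals are nonzero since `(c-a)(d-b) = (b-a)(d-c) + (c-b)(d-a)`.
  have hne : (c - b) * (d - a) ≠ 0 := by
    intro h0
    simp [h0] at h
  have he := (div_eq_one_iff_eq hne).1 h
  have h1 : (b - a) * (d - c) ≠ 0 := he ▸ hne
  have h2 : (c - a) * (d - b) ≠ 0 := by
    have : (c - a) * (d - b) = 2 * ((b - a) * (d - c)) := by linear_combination -he
    rw [this]
    exact mul_ne_zero two_ne_zero h1
  exact ⟨left_ne_zero_of_mul h1, left_ne_zero_of_mul hne, right_ne_zero_of_mul h1,
    right_ne_zero_of_mul hne, left_ne_zero_of_mul h2, right_ne_zero_of_mul h2, he⟩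

/-- The cross-ratio distortion of a harmonic quadruple compares the values of `φ_X`, interpolated
linearly along the diagonals, at the intersection point of the diagonals. -/
theorem exists_distortion_eq {a b c d : Circle} (h : crossRatio a b c d = 1) :
    ∃ ra rb rc rd : ℝ,
      (∀ X : Circle → ℂ, IsCircleField X → distortion X a b c d =
        ((rb * supportFun X b + rd * supportFun X d
          - (ra * supportFun X a + rc * supportFun X c) : ℝ) : ℂ)) ∧
      ra + rc = rb + rd ∧
      ra • (a : ℂ) + rc • (c : ℂ) = rb • (b : ℂ) + rd • (d : ℂ) ∧
      ra * rc * ‖(a - c : ℂ)‖ ^ 2 = 4 ∧ rb * rd * ‖(b - d : ℂ)‖ ^ 2 = 4 ∧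
      |rb| * (‖(b - a : ℂ)‖ * ‖(c - b : ℂ)‖) = ‖(c - a : ℂ)‖ := by
  obtain ⟨h1, h2, h3, h4, h5, h6, he⟩ := ne_of_crossRatio_eq_one h
  have ha := a.coe_ne_zero
  have hb := b.coe_ne_zero
  have hc := c.coe_ne_zero
  have hd := d.coe_ne_zero
  have h4' : (a - d : ℂ) ≠ 0 := by rwa [← neg_sub, neg_ne_zero]
  obtain ⟨ra, hra⟩ := exists_real_vertexCoeff d a b
  obtain ⟨rb, hrb⟩ := exists_real_vertexCoeff a b c
  obtain ⟨rc, hrc⟩ := exists_real_vertexCoeff b c d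
  obtain ⟨rd, hrd⟩ := exists_real_vertexCoeff c d a
  refine ⟨ra, rb, rc, rd, fun X hX => ?_, ?_, ?_, ?_, ?_, ?_⟩
  · simp only [distortion, eq_supportFun hX]
    push_cast
    rw [hra, hrb, hrc, hrd]
    simp only [vertexCoeff]
    field_simp
    ring
  -- This identity and the next say that the distortion vanishes on affine functions, that is, on
  -- Killing fields. They hold for all quadruples of distinct points; harmonicity `he` enters only
  -- in the two products equal to `4`.
  · have : ((ra + rc : ℝ) : ℂ) = ((rb + rd : ℝ) : ℂ) := by
      push_cast
      rw [hra, hrb, hrc, hrd]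
      simp only [vertexCoeff]
      field_simp
      ring
    exact_mod_cast this
  · simp only [Complex.real_smul]
    rw [hra, hrb, hrc, hrd]
    simp only [vertexCoeff]
    field_simp
    ring
  · have : ((ra * rc * ‖(a - c : ℂ)‖ ^ 2 : ℝ) : ℂ) = ((4 : ℝ) : ℂ) := by
      rw [Complex.ofReal_mul, norm_sub_sq_circle]
      push_cast
      rw [hra, hrc]
      simp only [vertexCoeff]
      field_simp
      linear_combination (-((b - a : ℂ) * (d - c) - (c - b) * (d - a))) * he -
        ((b - d : ℂ) * (d - b) * (a - c) ^ 2) * Complex.I_sq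
    exact_mod_cast this
  · have : ((rb * rd * ‖(b - d : ℂ)‖ ^ 2 : ℝ) : ℂ) = ((4 : ℝ) : ℂ) := by
      rw [Complex.ofReal_mul, norm_sub_sq_circle]
      push_cast
      rw [hrb, hrd]
      simp only [vertexCoeff]
      field_simp
      linear_combination (-((b - a : ℂ) * (d - c) - (c - b) * (d - a))) * he -
        ((c - a : ℂ) * (a - c) * (b - d) ^ 2) * Complex.I_sq
    exact_mod_cast this
  · have e : |rb| = ‖vertexCoeff a b c‖ := by rw [← hrb, Complex.norm_real, Real.norm_eq_abs]
    rw [e, vertexCoeff, norm_div, norm_mul, norm_mul, norm_mul, Complex.norm_I, Circle.norm_coe,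
      one_mul, one_mul, div_mul_cancel₀]
    simp [h1, h2]

/-- The cross-ratio norm is at most twice the width. -/
theorem crossRatioNorm_le {X : Circle → ℂ} (hX : IsCircleField X) (hXc : Continuous X) :
    crossRatioNorm X ≤ ENNReal.ofReal 2 * width X := by
  refine iSup_le fun a => iSup_le fun b => iSup_le fun c => iSup_le fun d => iSup_le fun h => ?_
  obtain ⟨ra, rb, rc, rd, hdist, hsum, hp, hac, hbd, -⟩ := exists_distortion_eq h
  rw [hdist X hX, Complex.norm_real, Real.norm_eq_abs]
  have hac0 : 0 < ra * rc := by
    by_contra hneg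
    linarith [mul_nonpos_of_nonpos_of_nonneg (not_lt.1 hneg) (sq_nonneg ‖(a - c : ℂ)‖)]
  have hbd0 : 0 < rb * rd := by
    by_contra hneg
    linarith [mul_nonpos_of_nonpos_of_nonneg (not_lt.1 hneg) (sq_nonneg ‖(b - d : ℂ)‖)]
  set K := ra + rc with hK
  have hK2 : 0 < K ^ 2 := by nlinarith [sq_nonneg ra, sq_nonneg rc]
  have hK0 : K ≠ 0 := by rintro h0; simp [h0] at hK2
  -- The sign of `K` depends on the orientation of the quadruple, but two coefficients with positive
  -- product and sum `K` always become nonnegative weights after division by `K`.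
  have quot : ∀ {r s : ℝ}, 0 < r * s → r + s = K → 0 ≤ r / K := by
    intro r s hrs hrsK
    have : r / K = (r ^ 2 + r * s) / K ^ 2 := by
      rw [← hrsK] at hK0 ⊢
      field_simp
    rw [this]
    positivity
  set p : ℂ := (ra / K) • (a : ℂ) + (rc / K) • (c : ℂ) with hpdef
  have hp' : (rb / K) • (b : ℂ) + (rd / K) • (d : ℂ) = p := by
    rw [hpdef, div_eq_inv_mul, div_eq_inv_mul, div_eq_inv_mul, div_eq_inv_mul, mul_smul, mul_smul,
      mul_smul, mul_smul, ← smul_add, ← smul_add, hp]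
  have hpn : 1 - ‖p‖ ^ 2 = 4 / K ^ 2 := by
    rw [← hac, norm_sq_eq_re_im, norm_sq_eq_re_im, hpdef]
    simp only [Complex.add_re, Complex.add_im, Complex.smul_re, Complex.smul_im, Complex.sub_re,
      Complex.sub_im, smul_eq_mul]
    have h1 := circle_re_im a
    have h2 := circle_re_im c
    field_simp
    rw [hK]
    linear_combination (-ra ^ 2 - ra * rc) * h1 + (-rc ^ 2 - ra * rc) * h2
  have hpd : p ∈ disc := by
    rw [mem_disc_iff, hpn]
    positivity
  have m1 := chord_mem_hull X a c (quot hac0 rfl) (quot (by linarith : 0 < rc * ra) (add_comm _ _))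
    (by rw [← add_div, div_self hK0])
  have m2 := chord_mem_hull X b d (quot hbd0 hsum.symm)
    (quot (by linarith : 0 < rd * rb) (by rw [hsum]; ring))
    (by rw [← add_div, ← hsum, div_self hK0])
  rw [hp'] at m2
  rw [← hpdef] at m1
  have hs : √(1 - ‖p‖ ^ 2) = 2 / |K| := by
    rw [hpn, Real.sqrt_div' _ hK2.le, Real.sqrt_sq_eq_abs]
    congr 1
    rw [show (4 : ℝ) = 2 ^ 2 by norm_num, Real.sqrt_sq zero_le_two]
  have w1 := ofReal_sub_div_le_width hXc hpd m1 m2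
  have w2 := ofReal_sub_div_le_width hXc hpd m2 m1
  have habs := abs_pos.2 hK0
  set D := rb * supportFun X b + rd * supportFun X d
    - (ra * supportFun X a + rc * supportFun X c) with hD
  have key : ENNReal.ofReal (|D| / 2) ≤ width X := by
    have e : |D| / 2 = |D / K| / (2 / |K|) := by
      rw [abs_div]
      field_simp
    rw [e]
    rw [hs] at w1 w2
    rcases abs_choice (D / K) with h' | h' <;> rw [h']
    · convert w1 using 3
      rw [hD]
      ring
    · convert w2 using 3
      rw [hD]
      ring
  calc ENNReal.ofReal |D| = ENNReal.ofReal 2 * ENNReal.ofReal (|D| / 2) := by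
        rw [← ENNReal.ofReal_mul zero_le_two]
        congr 1
        ring
    _ ≤ _ := by gcongr

/-- The harmonic conjugate of `b` with respect to `a` and `c`. -/
theorem exists_harmonic {a b c : Circle} (hba : b ≠ a) (hbc : b ≠ c) (hac : a ≠ c) :
    ∃ d : Circle, crossRatio a b c d = 1 := by
  have ha := a.coe_ne_zero
  have hb := b.coe_ne_zero
  have hc := c.coe_ne_zero
  have hba' : (b - a : ℂ) ≠ 0 := sub_ne_zero.2 fun h => hba (Circle.ext h)
  have hbc' : (c - b : ℂ) ≠ 0 := sub_ne_zero.2 fun h => hbc (Circle.ext h.symm)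
  have hac' : (a - c : ℂ) ≠ 0 := sub_ne_zero.2 fun h => hac (Circle.ext h)
  -- Otherwise `b` would be the midpoint of the chord from `a` to `c`, which is not on the circle.
  -- The formula for `d` below solves the linear equation `(b-a)(d-c) = (c-b)(d-a)`.
  have hden : (2 * b - a - c : ℂ) ≠ 0 := by
    intro h0
    have h1 := circle_re_im a
    have h2 := circle_re_im b
    have h3 := circle_re_im c
    have hre : 2 * (b : ℂ).re - (a : ℂ).re - (c : ℂ).re = 0 := by
      simpa using congrArg Complex.re h0
    have him : 2 * (b : ℂ).im - (a : ℂ).im - (c : ℂ).im = 0 := by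
      simpa using congrArg Complex.im h0
    have hsq : ((a : ℂ).re - (c : ℂ).re) ^ 2 + ((a : ℂ).im - (c : ℂ).im) ^ 2 = 0 := by
      have e1 : (a : ℂ).re + (c : ℂ).re = 2 * (b : ℂ).re := by linarith
      have e2 : (a : ℂ).im + (c : ℂ).im = 2 * (b : ℂ).im := by linarith
      linear_combination 2 * h1 + 2 * h3 - 4 * h2
        - ((a : ℂ).re + (c : ℂ).re + 2 * (b : ℂ).re) * e1
        - ((a : ℂ).im + (c : ℂ).im + 2 * (b : ℂ).im) * e2
    have : ‖(a - c : ℂ)‖ ^ 2 = 0 := by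
      rw [norm_sq_eq_re_im, Complex.sub_re, Complex.sub_im, hsq]
    exact hac' (norm_eq_zero.1 (pow_eq_zero_iff two_ne_zero |>.1 this))
  set d : ℂ := (b * c - 2 * a * c + a * b) / (2 * b - a - c) with hd
  have hnum : (b * c - 2 * a * c + a * b : ℂ)
      = -(a * b * c) * (starRingEnd ℂ) (2 * b - a - c : ℂ) := by
    simp only [map_sub, map_mul, conj_circle, map_ofNat]
    field_simp
    ring
  have hdn : ‖d‖ = 1 := by
    rw [hd, hnum, norm_div, norm_mul, norm_neg, norm_mul, norm_mul, RCLike.norm_conj,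
      Circle.norm_coe, Circle.norm_coe, Circle.norm_coe, one_mul, one_mul, one_mul,
      div_self (norm_ne_zero_iff.2 hden)]
  have hda : d - a = (a - c) * (a - b) / (2 * b - a - c) := by
    rw [hd, eq_div_iff hden, sub_mul, div_mul_cancel₀ _ hden]
    ring
  have hdc : d - c = (a - c) * (b - c) / (2 * b - a - c) := by
    rw [hd, eq_div_iff hden, sub_mul, div_mul_cancel₀ _ hden]
    ring
  refine ⟨⟨d, mem_sphere_zero_iff_norm.2 hdn⟩, ?_⟩
  change crossRatio a b c d = 1
  have hab' : (a - b : ℂ) ≠ 0 := by rwa [← neg_sub, neg_ne_zero]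
  rw [crossRatio, hda, hdc, div_eq_one_iff_eq
    (mul_ne_zero hbc' (div_ne_zero (mul_ne_zero hac' hab') hden))]
  ring

/-- If `φ_X` lies above the affine function of `v`, with contact points `a` and `c`, then it is
bounded above in terms of the cross-ratio norm. -/
theorem supportFun_sub_mul_le {X : Circle → ℂ} (hX : IsCircleField X) {C : ℝ} (hC : 0 ≤ C)
    (hXC : crossRatioNorm X ≤ ENNReal.ofReal C) {v : Mink}
    (hv : ∀ z : Circle, mink (lift z) v ≤ supportFun X z) {a c : Circle}
    (ha : supportFun X a = mink (lift a) v) (hc : supportFun X c = mink (lift c) v) (b : Circle) :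
    (supportFun X b - mink (lift b) v) * ‖(a - c : ℂ)‖ ≤ C * (‖(b - a : ℂ)‖ * ‖(b - c : ℂ)‖) := by
  by_cases hac : a = c
  · simp only [hac, sub_self, norm_zero, mul_zero]
    positivity
  by_cases hba : b = a
  · simp [hba, ha]
  by_cases hbc : b = c
  · simp [hbc, hc]
  obtain ⟨d, hd⟩ := exists_harmonic hba hbc hac
  obtain ⟨ra, rb, rc, rd, hdist, hsum, hp, -, hbd, hrb⟩ := exists_distortion_eq hd
  have hQ : ‖distortion X a b c d‖ ≤ C := by
    rw [← ENNReal.ofReal_le_ofReal_iff hC]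
    refine le_trans ?_ hXC
    exact le_iSup_of_le a <| le_iSup_of_le b <| le_iSup_of_le c <| le_iSup_of_le d <|
      le_iSup_of_le hd le_rfl
  rw [hdist X hX, Complex.norm_real, Real.norm_eq_abs] at hQ
  have hbd0 : 0 < rb * rd := by
    by_contra hneg
    linarith [mul_nonpos_of_nonpos_of_nonneg (not_lt.1 hneg) (sq_nonneg ‖(b - d : ℂ)‖)]
  set ψb := supportFun X b - mink (lift b) v with hψb
  set ψd := supportFun X d - mink (lift d) v with hψd
  have hψb0 : 0 ≤ ψb := sub_nonneg.2 (hv b)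
  have hψd0 : 0 ≤ ψd := sub_nonneg.2 (hv d)
  have hre := congrArg Complex.re hp
  have him := congrArg Complex.im hp
  simp only [Complex.add_re, Complex.add_im, Complex.smul_re, Complex.smul_im, smul_eq_mul]
    at hre him
  -- Replacing `φ_X` by its difference `ψ` with the affine function does not change the distortion,
  -- and `ψ` vanishes at `a` and `c`. As `rb` and `rd` have the same sign and `ψ ≥ 0`, neither
  -- remaining term can cancel the other.
  have e : rb * supportFun X b + rd * supportFun X d
      - (ra * supportFun X a + rc * supportFun X c) = rb * ψb + rd * ψd := by
    rw [ha, hc, hψb, hψd]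
    simp only [mink_lift]
    linear_combination v 0 * hsum - v 1 * hre - v 2 * him
  rw [e] at hQ
  have h1 : |rb| * ψb ≤ C := by
    rcases pos_and_pos_or_neg_and_neg_of_mul_pos hbd0 with ⟨hb, hd⟩ | ⟨hb, hd⟩
    · rw [abs_of_pos hb]
      have := le_abs_self (rb * ψb + rd * ψd)
      nlinarith
    · rw [abs_of_neg hb]
      have := neg_le_abs (rb * ψb + rd * ψd)
      nlinarith
  calc ψb * ‖(a - c : ℂ)‖ = |rb| * ψb * (‖(b - a : ℂ)‖ * ‖(b - c : ℂ)‖) := by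
        rw [norm_sub_rev (a : ℂ), ← hrb, norm_sub_rev (b : ℂ) c]
        ring
    _ ≤ _ := by gcongr

/-! ### The width is bounded by the cross-ratio norm -/

theorem norm_sub_circle_sq (b z : Circle) :
    ‖(b - z : ℂ)‖ ^ 2 = 2 * (1 - ((b : ℂ).re * (z : ℂ).re + (b : ℂ).im * (z : ℂ).im)) := by
  rw [norm_sq_eq_re_im, Complex.sub_re, Complex.sub_im]
  linear_combination circle_re_im b + circle_re_im z

theorem sum_norm_sub_sq {ι : Type*} [Fintype ι] {w : ι → ℝ} {b : ι → Circle} {η : ℂ}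
    (hw1 : ∑ k, w k = 1) (hη : ∑ k, w k • (b k : ℂ) = η) (z : Circle) :
    ∑ k, w k * ‖(b k - z : ℂ)‖ ^ 2 = 2 * (1 - (η.re * (z : ℂ).re + η.im * (z : ℂ).im)) := by
  rw [← hη]
  simp only [norm_sub_circle_sq, Complex.re_sum, Complex.im_sum, Complex.real_smul,
    Complex.re_ofReal_mul, Complex.im_ofReal_mul, Finset.sum_mul]
  rw [← Finset.sum_add_distrib, ← hw1, ← Finset.sum_sub_distrib, Finset.mul_sum]
  refine Finset.sum_congr rfl fun k _ => ?_
  rw [hw1]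
  ring

/-- Let the lowest point be a barycentre of graph points `z i` with weights `w i`, and `(η, t)` one
of graph points `b k` with weights `u k`. For contact points `z i`, `z j`, `supportFun_sub_mul_le`
averaged over `k` and Cauchy–Schwarz give `D² |z j - z i|² ≤ C² h i h j`. Here `h i = ∑ u k |b k - z
i|² = 2 (1 - η·z i)` depends on the `b k` only through `η`; hence also `h i = ∑ w j |z j - z i|²`.
Averaging with weights `w i w j` yields `D² m ≤ C² m²`, where `m = ∑ w i h i = 2 (1 - ‖η‖²)`. -/
theorem sq_height_le {X : Circle → ℂ} (hX : IsCircleField X) {C : ℝ} (hC : 0 ≤ C)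
    (hXC : crossRatioNorm X ≤ ENNReal.ofReal C) {v : Mink}
    (hv : ∀ z : Circle, mink (lift z) v ≤ supportFun X z) {η : ℂ} (hη : η ∈ disc)
    (hl : (η, mink (lift η) v) ∈ hull X) {t : ℝ} (ht : (η, t) ∈ hull X) :
    (t - mink (lift η) v) ^ 2 ≤ 2 * (1 - ‖η‖ ^ 2) * C ^ 2 := by
  obtain ⟨ι, _, w, z, hw, hw1, hwz, hwφ⟩ := mem_hull_iff.1 hl
  obtain ⟨κ, _, u, b, hu, hu1, hub, huφ⟩ := mem_hull_iff.1 ht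
  simp only at hwz hwφ hub huφ
  set h : ι → ℝ := fun i => 2 * (1 - (η.re * (z i : ℂ).re + η.im * (z i : ℂ).im)) with hh
  set D := t - mink (lift η) v with hD
  have hR := mem_disc_iff.1 hη
  -- The gaps between `φ_X` and the support plane are nonnegative with weighted sum zero, so every
  -- point of positive weight is a contact point.
  have hcontact : ∀ i, w i * (supportFun X (z i) - mink (lift (z i)) v) = 0 := by
    have h0 : ∑ i, w i * (supportFun X (z i) - mink (lift (z i)) v) = 0 := by
      simp only [mul_sub, Finset.sum_sub_distrib]
      rw [hwφ, ← mink_lift_affine ι w _ hw1, hwz, sub_self]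
    have := (Finset.sum_eq_zero_iff_of_nonneg fun i _ =>
      mul_nonneg (hw i) (sub_nonneg.2 (hv (z i)))).1 h0
    exact fun i => this i (Finset.mem_univ i)
  have hDsum : D = ∑ k, u k * (supportFun X (b k) - mink (lift (b k)) v) := by
    simp only [mul_sub, Finset.sum_sub_distrib]
    rw [huφ, ← mink_lift_affine κ u _ hu1, hub]
  have hD0 : 0 ≤ D := by
    rw [hDsum]
    exact Finset.sum_nonneg fun k _ => mul_nonneg (hu k) (sub_nonneg.2 (hv _))
  have hpair : ∀ i j, w i * w j * (D ^ 2 * ‖(z j - z i : ℂ)‖ ^ 2)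
      ≤ w i * w j * (C ^ 2 * (h i * h j)) := by
    intro i j
    rcases mul_eq_zero.1 (hcontact i) with hi | hi
    · simp [hi]
    rcases mul_eq_zero.1 (hcontact j) with hj | hj
    · simp [hj]
    refine mul_le_mul_of_nonneg_left ?_ (mul_nonneg (hw i) (hw j))
    set σ := ∑ k, u k * (‖(b k - z j : ℂ)‖ * ‖(b k - z i : ℂ)‖) with hσ
    have hσ0 : 0 ≤ σ := Finset.sum_nonneg fun k _ =>
      mul_nonneg (hu k) (mul_nonneg (norm_nonneg _) (norm_nonneg _))
    have h1 : D * ‖(z j - z i : ℂ)‖ ≤ C * σ := by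
      rw [hDsum, hσ, Finset.sum_mul, Finset.mul_sum]
      refine Finset.sum_le_sum fun k _ => ?_
      have := supportFun_sub_mul_le hX hC hXC hv (sub_eq_zero.1 hj) (sub_eq_zero.1 hi) (b k)
      calc _ = u k * ((supportFun X (b k) - mink (lift (b k)) v) * ‖(z j - z i : ℂ)‖) := by ring
        _ ≤ u k * (C * (‖(b k - z j : ℂ)‖ * ‖(b k - z i : ℂ)‖)) :=
          mul_le_mul_of_nonneg_left this (hu k)
        _ = _ := by ring
    have h2 : σ ^ 2 ≤ h j * h i := by
      rw [hh]
      simp only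
      rw [← sum_norm_sub_sq hu1 hub (z i), ← sum_norm_sub_sq hu1 hub (z j)]
      refine Finset.sum_sq_le_sum_mul_sum_of_sq_le_mul _
        (fun k _ => mul_nonneg (hu k) (sq_nonneg _))
        (fun k _ => mul_nonneg (hu k) (sq_nonneg _)) fun k _ => le_of_eq ?_
      ring
    calc D ^ 2 * ‖(z j - z i : ℂ)‖ ^ 2 = (D * ‖(z j - z i : ℂ)‖) ^ 2 := by ring
      _ ≤ (C * σ) ^ 2 := by gcongr
      _ = C ^ 2 * σ ^ 2 := by ring
      _ ≤ C ^ 2 * (h i * h j) := by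
        rw [mul_comm (h i)]
        gcongr
  have hsumh : ∑ i, w i * h i = 2 * (1 - ‖η‖ ^ 2) := by
    rw [norm_sq_eq_re_im]
    have hre : ∑ i, w i * (z i : ℂ).re = η.re := by
      rw [← hwz]
      simp [Complex.re_sum]
    have him : ∑ i, w i * (z i : ℂ).im = η.im := by
      rw [← hwz]
      simp [Complex.im_sum]
    calc ∑ i, w i * h i = 2 * (∑ i, w i - (η.re * ∑ i, w i * (z i : ℂ).re
          + η.im * ∑ i, w i * (z i : ℂ).im)) := by
          rw [Finset.mul_sum, Finset.mul_sum, ← Finset.sum_add_distrib, ← Finset.sum_sub_distrib,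
            Finset.mul_sum]
          refine Finset.sum_congr rfl fun i _ => ?_
          rw [hh]
          ring
      _ = _ := by
          rw [hw1, hre, him]
          ring
  have hL : ∑ i, ∑ j, w i * w j * (D ^ 2 * ‖(z j - z i : ℂ)‖ ^ 2)
      = D ^ 2 * (2 * (1 - ‖η‖ ^ 2)) := by
    rw [← hsumh, Finset.mul_sum]
    refine Finset.sum_congr rfl fun i _ => ?_
    rw [hh]
    simp only
    rw [← sum_norm_sub_sq hw1 hwz (z i), Finset.mul_sum, Finset.mul_sum]
    refine Finset.sum_congr rfl fun j _ => ?_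
    ring
  have hRt : ∑ i, ∑ j, w i * w j * (C ^ 2 * (h i * h j)) = C ^ 2 * (2 * (1 - ‖η‖ ^ 2)) ^ 2 := by
    rw [← hsumh, sq (∑ i, w i * h i), Finset.sum_mul_sum, Finset.mul_sum]
    refine Finset.sum_congr rfl fun i _ => ?_
    rw [Finset.mul_sum]
    refine Finset.sum_congr rfl fun j _ => ?_
    ring
  have hfin := Finset.sum_le_sum fun i (_ : i ∈ Finset.univ) =>
    Finset.sum_le_sum fun j (_ : j ∈ Finset.univ) => hpair i j
  rw [hL, hRt] at hfin
  refine le_of_mul_le_mul_right ?_ (by linarith : 0 < 2 * (1 - ‖η‖ ^ 2))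
  linarith

theorem width_le {X : Circle → ℂ} (hX : IsCircleField X) (hXc : Continuous X) :
    width X ≤ ENNReal.ofReal (8 / 3) * crossRatioNorm X := by
  by_cases htop : crossRatioNorm X = ⊤
  · rw [htop, ENNReal.mul_top (by simp)]
    exact le_top
  set C := (crossRatioNorm X).toReal with hC
  have hC0 : 0 ≤ C := ENNReal.toReal_nonneg
  have hXC : crossRatioNorm X = ENNReal.ofReal C := (ENNReal.ofReal_toReal htop).symm
  refine iSup_le fun η => iSup_le fun s => iSup_le fun t => iSup_le fun hs => iSup_le fun ht => ?_
  have hη : η ∈ disc := hs.2.1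
  obtain ⟨v, hv, hl⟩ := exists_support hXc hη
  have hsv : s = mink (lift η) v := le_antisymm (hs.2.2 _ hl) (mink_le_of_mem_hull hv hs.1)
  have hsq := sq_height_le hX hC0 hXC.le hv hη hl ht.1
  rw [hXC, ← ENNReal.ofReal_mul (by norm_num)]
  refine ENNReal.ofReal_le_ofReal ?_
  have hR := mem_disc_iff.1 hη
  rw [height, height, ← sub_div, mink_lift_self, abs_div, abs_of_nonneg (Real.sqrt_nonneg _),
    div_le_iff₀ (Real.sqrt_pos.2 hR), hsv]
  refine abs_le_of_sq_le_sq (hsq.trans ?_) (by positivity)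
  rw [mul_pow, mul_pow, Real.sq_sqrt hR.le]
  -- Only `2 ≤ (8/3)²` is used.
  nlinarith [mul_nonneg hR.le (sq_nonneg C)]

theorem isZygmund_iff {X : Circle → ℂ} (hX : IsCircleField X) (hXc : Continuous X) :
    IsZygmund X ↔ width X < ⊤ := by
  refine ⟨fun h => (width_le hX hXc).trans_lt ?_,
    fun h => ⟨hXc, (crossRatioNorm_le hX hXc).trans_lt ?_⟩⟩
  · exact ENNReal.mul_lt_top ENNReal.ofReal_lt_top h.2
  · exact ENNReal.mul_lt_top ENNReal.ofReal_lt_top h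

/-! ### Angles between support planes -/

/-- The hyperbolic cosine of the distance of two points of the disc. -/
def coshDist (x y : ℂ) : ℝ := -mink (lift x) (lift y) / (√(1 - ‖x‖ ^ 2) * √(1 - ‖y‖ ^ 2))

theorem mink_lift_lift (x y : ℂ) :
    mink (lift x) (lift y) = -(1 - (x.re * y.re + x.im * y.im)) := by
  simp [mink, lift]
  ring

theorem coshDist_sq_mul {x y : ℂ} (hx : x ∈ disc) (hy : y ∈ disc) :
    coshDist x y ^ 2 * ((1 - ‖x‖ ^ 2) * (1 - ‖y‖ ^ 2)) = mink (lift x) (lift y) ^ 2 := by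
  have h1 := mem_disc_iff.1 hx
  have h2 := mem_disc_iff.1 hy
  rw [coshDist, div_pow, mul_pow, Real.sq_sqrt h1.le, Real.sq_sqrt h2.le, neg_sq,
    div_mul_cancel₀ _ (by positivity)]

theorem one_le_coshDist {x y : ℂ} (hx : x ∈ disc) (hy : y ∈ disc) : 1 ≤ coshDist x y := by
  have h1 := mem_disc_iff.1 hx
  have h2 := mem_disc_iff.1 hy
  rw [coshDist, mink_lift_lift, neg_neg, one_le_div (by positivity),
    ← Real.sqrt_mul h1.le]
  rw [norm_sq_eq_re_im] at h1 h2
  refine Real.sqrt_le_iff.2 ⟨?_, ?_⟩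
  · nlinarith [sq_nonneg (x.re - y.re), sq_nonneg (x.im - y.im)]
  · rw [norm_sq_eq_re_im, norm_sq_eq_re_im]
    have e : (1 - (x.re * y.re + x.im * y.im)) ^ 2
        - (1 - (x.re ^ 2 + x.im ^ 2)) * (1 - (y.re ^ 2 + y.im ^ 2))
        = ((x.re - y.re) ^ 2 + (x.im - y.im) ^ 2) * (1 - (x.re ^ 2 + x.im ^ 2))
          + (x.re * (x.re - y.re) + x.im * (x.im - y.im)) ^ 2 := by ring
    have h3 : 0 ≤ ((x.re - y.re) ^ 2 + (x.im - y.im) ^ 2) * (1 - (x.re ^ 2 + x.im ^ 2)) := by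
      positivity
    linarith [sq_nonneg (x.re * (x.re - y.re) + x.im * (x.im - y.im))]

theorem coshDist_eq_of_hypDist_eq {x y : ℂ} (hx : x ∈ disc) (hy : y ∈ disc)
    (h : hypDist x y = 1) : coshDist x y = Real.cosh 1 := by
  rw [← h]
  exact (Real.cosh_arcosh (one_le_coshDist hx hy)).symm

/-- The distance of a point to an axis which separates it from another point is at most the
distance of the two points. -/
theorem sq_mink_lift_le {x y : ℂ} (hx : x ∈ disc) (hy : y ∈ disc) {a : Mink}
    (hxa : mink (lift x) a ≤ 0) (hya : 0 ≤ mink (lift y) a) :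
    mink (lift x) a ^ 2 ≤ mink a a * (1 - ‖x‖ ^ 2) * (coshDist x y ^ 2 - 1) := by
  have h1 := mem_disc_iff.1 hx
  have h2 := mem_disc_iff.1 hy
  have hsq := coshDist_sq_mul hx hy
  have hxy : mink (lift x) (lift y) ≤ 0 := by
    rw [mink_lift_lift]
    rw [norm_sq_eq_re_im] at h1 h2
    nlinarith [sq_nonneg (x.re - y.re), sq_nonneg (x.im - y.im)]
  -- The Gram determinant of three vectors in signature `(-,+,+)` is minus the square of their
  -- determinant. The separation hypotheses make the mixed term nonnegative, so it can be dropped.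
  have gram : (1 - ‖x‖ ^ 2) * (1 - ‖y‖ ^ 2) * mink a a + (1 - ‖x‖ ^ 2) * mink (lift y) a ^ 2
      - mink (lift x) (lift y) ^ 2 * mink a a
      + 2 * mink (lift x) (lift y) * mink (lift x) a * mink (lift y) a
      + (1 - ‖y‖ ^ 2) * mink (lift x) a ^ 2
      = -(Matrix.of ![lift x, lift y, a]).det ^ 2 := by
    rw [norm_sq_eq_re_im, norm_sq_eq_re_im]
    simp [mink, lift, Matrix.det_fin_three]
    ring
  have hprod : 0 ≤ mink (lift x) (lift y) * mink (lift x) a * mink (lift y) a :=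
    mul_nonneg (mul_nonneg_of_nonpos_of_nonpos hxy hxa) hya
  have h3 := mul_nonneg h1.le (sq_nonneg (mink (lift y) a))
  refine le_of_mul_le_mul_right ?_ h2
  have h4 : mink a a * (1 - ‖x‖ ^ 2) * (coshDist x y ^ 2 - 1) * (1 - ‖y‖ ^ 2)
      = mink (lift x) (lift y) ^ 2 * mink a a - (1 - ‖x‖ ^ 2) * (1 - ‖y‖ ^ 2) * mink a a := by
    rw [← hsq]
    ring
  linarith [sq_nonneg (Matrix.of ![lift x, lift y, a]).det]

/-- Take `z` in the direction of the spatial part of `q`. The product is then the length of that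
part minus `q 0`, which is nonnegative because `q` is not timelike. -/
theorem exists_circle_mink_nonneg {q : Mink} (hq : 0 ≤ mink q q) :
    ∃ z : Circle, 0 ≤ mink (lift z) q := by
  simp only [mink] at hq
  by_cases h0 : q 1 ^ 2 + q 2 ^ 2 = 0
  · have h1 : q 1 = 0 := by nlinarith [sq_nonneg (q 1), sq_nonneg (q 2)]
    have h2 : q 2 = 0 := by nlinarith [sq_nonneg (q 1), sq_nonneg (q 2)]
    have h3 : q 0 = 0 := by
      rw [h1, h2] at hq
      nlinarith [sq_nonneg (q 0)]
    exact ⟨1, by simp [mink_lift, h1, h2, h3]⟩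
  · have hpos : 0 < q 1 ^ 2 + q 2 ^ 2 := lt_of_le_of_ne (by positivity) (Ne.symm h0)
    set r := √(q 1 ^ 2 + q 2 ^ 2) with hr
    have hr0 : 0 < r := Real.sqrt_pos.2 hpos
    have hr2 : r ^ 2 = q 1 ^ 2 + q 2 ^ 2 := Real.sq_sqrt hpos.le
    obtain ⟨z, h1, h2⟩ := exists_circle (c := q 1 / r) (d := q 2 / r) (by
      rw [div_pow, div_pow, ← add_div, hr2, div_self hpos.ne'])
    refine ⟨z, ?_⟩
    have h3 : q 0 ≤ r := Real.le_sqrt_of_sq_le (by linarith)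
    have h4 : q 1 / r * q 1 + q 2 / r * q 2 = r := by
      field_simp
      linarith
    rw [mink_lift, h1, h2]
    linarith

/-- The chord through `x` on whose end point the affine function of `a` is large compared to the
distance to `x`. -/
theorem exists_circle_large {x : ℂ} (hx : x ∈ disc) {a : Mink} (ha : 0 ≤ mink a a) {κ S : ℝ}
    (hκ : 0 ≤ κ) (hS : 0 ≤ S) (hκS : 0 ≤ 1 - 4 * κ * S - 4 * κ ^ 2)
    (hxa : mink (lift x) a ^ 2 ≤ mink a a * (1 - ‖x‖ ^ 2) * S ^ 2) :
    ∃ z : Circle, 2 * κ * √(mink a a) * (1 - (x.re * (z : ℂ).re + x.im * (z : ℂ).im))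
      ≤ √(1 - ‖x‖ ^ 2) * mink (lift z) a := by
  have hR := mem_disc_iff.1 hx
  set ρ := √(1 - ‖x‖ ^ 2) with hρ
  set σ := √(mink a a) with hσ
  have hρ2 : ρ ^ 2 = 1 - ‖x‖ ^ 2 := Real.sq_sqrt hR.le
  have hσ2 : σ ^ 2 = mink a a := Real.sq_sqrt ha
  have hρ0 : 0 ≤ ρ := Real.sqrt_nonneg _
  have hσ0 : 0 ≤ σ := Real.sqrt_nonneg _
  have hlow : -(σ * ρ * S) ≤ mink (lift x) a := by
    refine (abs_le.1 (abs_le_of_sq_le_sq ?_ (by positivity))).1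
    rw [mul_pow, mul_pow, hσ2, hρ2]
    exact hxa
  -- As `⟨(1,z), (1,x)⟩ = -(1 - x·z)`, the claim says that this vector has nonnegative product with
  -- `(1,z)`. Its square is at least `σ² ρ² (1 - 4κS - 4κ²)`, whence the condition on `κ` and `S`.
  obtain ⟨z, hz⟩ := exists_circle_mink_nonneg (q := ρ • a + (2 * κ * σ) • lift x) (by
    have e : mink (ρ • a + (2 * κ * σ) • lift x) (ρ • a + (2 * κ * σ) • lift x)
        = ρ ^ 2 * mink a a + 4 * κ * σ * ρ * mink (lift x) a
          - 4 * κ ^ 2 * σ ^ 2 * -mink (lift x) (lift x) := by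
      simp only [mink, Pi.add_apply, Pi.smul_apply, smul_eq_mul]
      ring
    rw [e, mink_lift_self, ← hρ2, ← hσ2]
    have h1 : 4 * κ * σ * ρ * -(σ * ρ * S) ≤ 4 * κ * σ * ρ * mink (lift x) a := by gcongr
    have h2 := mul_nonneg (sq_nonneg (σ * ρ)) hκS
    nlinarith)
  refine ⟨z, ?_⟩
  have e : mink (lift z) (ρ • a + (2 * κ * σ) • lift x) = ρ * mink (lift z) a
      - 2 * κ * σ * (1 - (x.re * (z : ℂ).re + x.im * (z : ℂ).im)) := by
    simp [mink, lift]
    ring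
  rw [e] at hz
  linarith

/-- The angle between two support planes from below is bounded by the width. -/
theorem ofReal_mul_sqrt_le_width {X : Circle → ℂ} (hXc : Continuous X) {x y : ℂ} (hx : x ∈ disc)
    (hy : y ∈ disc) {κ S : ℝ} (hκ : 0 ≤ κ) (hS : 0 ≤ S) (hκS : 0 ≤ 1 - 4 * κ * S - 4 * κ ^ 2)
    (hd : coshDist x y ^ 2 - 1 ≤ S ^ 2) {v w : Mink}
    (hv : ∀ z : Circle, mink (lift z) v ≤ supportFun X z) (hvx : (x, mink (lift x) v) ∈ hull X)
    (hw : ∀ z : Circle, mink (lift z) w ≤ supportFun X z) (hwy : (y, mink (lift y) w) ∈ hull X) :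
    ENNReal.ofReal (κ * √(mink (w - v) (w - v))) ≤ width X := by
  by_cases ha : 0 ≤ mink (w - v) (w - v)
  swap
  -- The square root of a negative number is `0`, so a timelike difference needs no estimate.
  · rw [Real.sqrt_eq_zero_of_nonpos (not_le.1 ha).le, mul_zero, ENNReal.ofReal_zero]
    exact zero_le
  have hR := mem_disc_iff.1 hx
  have hxa : mink (lift x) (w - v) ≤ 0 := by
    rw [mink_lift_sub]
    linarith [mink_le_of_mem_hull hw hvx]
  have hya : 0 ≤ mink (lift y) (w - v) := by
    rw [mink_lift_sub]
    linarith [mink_le_of_mem_hull hv hwy]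
  obtain ⟨z, hz⟩ := exists_circle_large hx ha hκ hS hκS
    ((sq_mink_lift_le hx hy hxa hya).trans
      (mul_le_mul_of_nonneg_left hd (mul_nonneg ha hR.le)))
  obtain ⟨z', α, β, hα, hβ, hαβ, e, hh⟩ := exists_chord hx z
  have hm := chord_mem_hull X z z' hα.le hβ.le hαβ
  rw [e] at hm
  refine le_trans (ENNReal.ofReal_le_ofReal ?_) (ofReal_sub_div_le_width hXc hx hvx hm)
  have hρ := Real.sqrt_pos.2 hR
  rw [le_div_iff₀ hρ]
  have hx' : mink (lift x) v = α * mink (lift z) v + β * mink (lift z') v := by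
    rw [← e, mink_lift_combo hαβ]
  -- Over `x`, the chord from `z` to `z'` is bounded below by using the plane of `w` at `z` and that
  -- of `v` at `z'`; the excess over the plane of `v` is `α ⟨(1,z), w - v⟩`.
  have h1 : α * mink (lift z) (w - v) ≤ α * supportFun X z + β * supportFun X z'
      - mink (lift x) v := by
    rw [hx', mink_lift_sub]
    nlinarith [mul_le_mul_of_nonneg_left (hw z) hα.le, mul_le_mul_of_nonneg_left (hv z') hβ.le]
  refine le_trans ?_ h1
  refine le_of_mul_le_mul_right ?_ hρ
  have h2 := mul_le_mul_of_nonneg_left hz hα.le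
  have hρ2 := Real.sq_sqrt hR.le
  calc κ * √(mink (w - v) (w - v)) * √(1 - ‖x‖ ^ 2) * √(1 - ‖x‖ ^ 2)
      = κ * √(mink (w - v) (w - v)) * √(1 - ‖x‖ ^ 2) ^ 2 := by ring
    _ = κ * √(mink (w - v) (w - v)) * (2 * α * (1 - (x.re * (z : ℂ).re + x.im * (z : ℂ).im))) := by
        rw [hρ2, hh]
    _ = α * (2 * κ * √(mink (w - v) (w - v)) * (1 - (x.re * (z : ℂ).re + x.im * (z : ℂ).im))) := by
        ring
    _ ≤ _ := h2
    _ = _ := by ring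

/-! ### Support planes -/

theorem exists_mem_normalBundle {X : Circle → ℂ} (hXc : Continuous X) (s : Side) {η : ℂ}
    (hη : η ∈ disc) : ∃ v, (η, v) ∈ normalBundle s X := by
  cases s with
  | left =>
    obtain ⟨v, hv, hl⟩ := exists_support hXc hη
    exact ⟨v, ⟨hl, hη, fun t ht => mink_le_of_mem_hull hv ht⟩,
      fun q hq => mink_le_of_mem_hull hv hq⟩
  | right =>
    obtain ⟨v, hv, hl⟩ := exists_support (X := -X) hXc.neg hη
    have hv' : ∀ z : Circle, supportFun X z ≤ mink (lift z) (-v) := fun z => by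
      have := hv z
      rw [supportFun_neg] at this
      rw [mink_lift_neg]
      linarith
    have hl' : (η, mink (lift η) (-v)) ∈ hull X := by
      rw [mink_lift_neg]
      exact mem_hull_neg.1 hl
    exact ⟨-v, ⟨hl', hη, fun t ht => le_mink_of_mem_hull hv' ht⟩,
      fun q hq => le_mink_of_mem_hull hv' hq⟩

theorem ofReal_mul_sqrt_le_width_of_mem_normalBundle {X : Circle → ℂ} (hXc : Continuous X)
    (s : Side) {x y : ℂ} {κ S : ℝ} (hκ : 0 ≤ κ) (hS : 0 ≤ S)
    (hκS : 0 ≤ 1 - 4 * κ * S - 4 * κ ^ 2) (hd : coshDist x y ^ 2 - 1 ≤ S ^ 2) {v w : Mink}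
    (hv : (x, v) ∈ normalBundle s X) (hw : (y, w) ∈ normalBundle s X) :
    ENNReal.ofReal (κ * √(mink (w - v) (w - v))) ≤ width X := by
  cases s with
  | left =>
    exact ofReal_mul_sqrt_le_width hXc hv.1.2.1 hw.1.2.1 hκ hS hκS hd
      (fun z => hv.2 _ (graph_mem_hull X z)) hv.1.1 (fun z => hw.2 _ (graph_mem_hull X z)) hw.1.1
  | right =>
    have h1 : ∀ {p : ℂ} {u : Mink}, (p, u) ∈ normalBundle .right X →
        ∀ z : Circle, mink (lift z) (-u) ≤ supportFun (-X) z := by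
      intro p u hu z
      rw [mink_lift_neg, supportFun_neg]
      exact neg_le_neg (hu.2 _ (graph_mem_hull X z))
    have h2 : ∀ {p : ℂ} {u : Mink}, (p, u) ∈ normalBundle .right X →
        (p, mink (lift p) (-u)) ∈ hull (-X) := by
      intro p u hu
      rw [mem_hull_neg, mink_lift_neg, neg_neg]
      exact hu.1.1
    have h := ofReal_mul_sqrt_le_width hXc.neg hv.1.2.1 hw.1.2.1 hκ hS hκS hd
      (h1 hv) (h2 hv) (h1 hw) (h2 hw)
    have e : mink (-w - -v) (-w - -v) = mink (w - v) (w - v) := by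
      simp only [mink, Pi.sub_apply, Pi.neg_apply]
      ring
    rw [e] at h
    exact h.trans (width_neg X)

/-! ### The space of geodesics -/

/-- The geodesic with given distinct end points. -/
def Geodesic.mk (p : {p : Circle × Circle // p.1 ≠ p.2}) : Geodesic := Quotient.mk pairSetoid p

theorem Geodesic.exists_mk (g : Geodesic) : ∃ p, Geodesic.mk p = g := Quotient.exists_rep g

theorem Geodesic.line_mk (p : {p : Circle × Circle // p.1 ≠ p.2}) :
    (Geodesic.mk p).line = openSegment ℝ (p.1.1 : ℂ) (p.1.2 : ℂ) := rfl

theorem Geodesic.isQuotientMap_mk : IsQuotientMap Geodesic.mk := isQuotientMap_quot_mk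

theorem Geodesic.isOpenMap_mk : IsOpenMap Geodesic.mk := by
  intro U hU
  rw [← Geodesic.isQuotientMap_mk.isOpen_preimage]
  let sw : {p : Circle × Circle // p.1 ≠ p.2} → {p : Circle × Circle // p.1 ≠ p.2} :=
    fun p => ⟨p.1.swap, p.2.symm⟩
  have hsw : Continuous sw := by
    refine Continuous.subtype_mk ?_ _
    fun_prop
  have : Geodesic.mk ⁻¹' (Geodesic.mk '' U) = U ∪ sw ⁻¹' U := by
    ext p
    constructor
    · rintro ⟨q, hq, hqp⟩
      rcases (Quotient.exact hqp : q.1 = p.1 ∨ q.1 = p.1.swap) with h | h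
      · left
        rwa [← Subtype.ext h]
      · right
        have : sw p = q := Subtype.ext h.symm
        rwa [mem_preimage, this]
    · rintro (h | h)
      · exact ⟨p, h, rfl⟩
      · exact ⟨sw p, h, Quotient.sound (Or.inr rfl)⟩
  rw [this]
  exact hU.union (hU.preimage hsw)

/-- Needed in `countable_atoms`, where the complement of the support must be a null set. -/
instance : SecondCountableTopology Geodesic :=
  Geodesic.isQuotientMap_mk.secondCountableTopology Geodesic.isOpenMap_mk

theorem mem_openSegment_iff_lineMap {a b x : ℂ} :
    x ∈ openSegment ℝ a b ↔ ∃ γ : ℝ, 0 < γ ∧ γ < 1 ∧ AffineMap.lineMap a b γ = x := by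
  rw [openSegment_eq_image_lineMap]
  simp [and_assoc]

theorem norm_sq_combo_circle (a b : Circle) (γ : ℝ) :
    ‖AffineMap.lineMap (a : ℂ) (b : ℂ) γ‖ ^ 2 = 1 - γ * (1 - γ) * ‖(a - b : ℂ)‖ ^ 2 := by
  rw [AffineMap.lineMap_apply_module, norm_sq_eq_re_im, norm_sq_eq_re_im]
  simp only [Complex.add_re, Complex.add_im, Complex.smul_re, Complex.smul_im, Complex.sub_re,
      Complex.sub_im, smul_eq_mul]
  linear_combination (1 - γ) * circle_re_im a + γ * circle_re_im b

theorem lineMap_mem_disc_iff {a b : Circle} (hab : a ≠ b) {γ : ℝ} :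
    AffineMap.lineMap (a : ℂ) (b : ℂ) γ ∈ disc ↔ 0 < γ ∧ γ < 1 := by
  have hab' : 0 < ‖(a - b : ℂ)‖ ^ 2 :=
    pow_pos (norm_pos_iff.2 (sub_ne_zero.2 fun h => hab (Circle.ext h))) 2
  rw [mem_disc_iff, norm_sq_combo_circle, sub_sub_cancel, mul_pos_iff_of_pos_right hab']
  constructor
  · intro h
    constructor <;> nlinarith
  · rintro ⟨h1, h2⟩
    exact mul_pos h1 (by linarith)

theorem Geodesic.line_subset_disc (g : Geodesic) : g.line ⊆ disc := by
  obtain ⟨⟨p, hp⟩, rfl⟩ := g.exists_mk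
  intro x hx
  obtain ⟨γ, h0, h1, rfl⟩ := mem_openSegment_iff_lineMap.1 hx
  exact (lineMap_mem_disc_iff hp).2 ⟨h0, h1⟩

/-- In the disc, a geodesic contains the line through any two of its points. -/
theorem Geodesic.lineMap_mem_line (g : Geodesic) {p q : ℂ} (hp : p ∈ g.line) (hq : q ∈ g.line)
    {s : ℝ} (hs : AffineMap.lineMap p q s ∈ disc) : AffineMap.lineMap p q s ∈ g.line := by
  obtain ⟨⟨e, he⟩, rfl⟩ := g.exists_mk
  obtain ⟨α, -, -, rfl⟩ := mem_openSegment_iff_lineMap.1 hp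
  obtain ⟨β, -, -, rfl⟩ := mem_openSegment_iff_lineMap.1 hq
  have h : AffineMap.lineMap (AffineMap.lineMap (e.1 : ℂ) (e.2 : ℂ) α)
      (AffineMap.lineMap (e.1 : ℂ) (e.2 : ℂ) β) s
      = AffineMap.lineMap (e.1 : ℂ) (e.2 : ℂ) (AffineMap.lineMap α β s) :=
    (AffineMap.apply_lineMap (AffineMap.lineMap (e.1 : ℂ) (e.2 : ℂ)) α β s).symm
  rw [h] at hs ⊢
  obtain ⟨h0, h1⟩ := (lineMap_mem_disc_iff he).1 hs
  exact mem_openSegment_iff_lineMap.2 ⟨_, h0, h1, rfl⟩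

/-- For a point of the open disc, the open and the closed chord are the same condition. The equality
of distances is closed in the end points and still makes sense when they coincide. -/
theorem mem_openSegment_iff_dist {a b : Circle} {x : ℂ} (hx : x ∈ disc) :
    x ∈ openSegment ℝ (a : ℂ) (b : ℂ) ↔ dist (a : ℂ) x + dist x b = dist (a : ℂ) b := by
  rw [dist_add_dist_eq_iff, ← mem_segment_iff_wbtw]
  refine ⟨fun h => openSegment_subset_segment _ _ _ h, fun h => ?_⟩
  have hne : ∀ z : Circle, (z : ℂ) ≠ x := by
    rintro z rfl
    exact (mem_ball_zero_iff.1 hx).ne (Circle.norm_coe z)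
  exact mem_openSegment_of_ne_left_right (hne a) (hne b) h

theorem isClosed_setOf_mem_line (x : ℂ) : IsClosed {g : Geodesic | x ∈ g.line} := by
  by_cases hx : x ∈ disc
  · rw [← Geodesic.isQuotientMap_mk.isClosed_preimage]
    have : Geodesic.mk ⁻¹' {g : Geodesic | x ∈ g.line} = {p | dist (p.1.1 : ℂ) x
        + dist x (p.1.2 : ℂ) = dist (p.1.1 : ℂ) (p.1.2 : ℂ)} := by
      ext p
      exact mem_openSegment_iff_dist hx
    rw [this]
    exact isClosed_eq (by fun_prop) (by fun_prop)
  · convert isClosed_empty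
    ext g
    simp only [mem_ofPred_eq, mem_empty_iff_false, iff_false]
    exact fun h => hx (g.line_subset_disc h)

/-- The complement of the leaves of a closed set of geodesics is open. -/
theorem isOpen_disc_diff_leavesUnion {Λ : Set Geodesic} (hΛ : IsClosed Λ) :
    IsOpen (disc \ leavesUnion Λ) := by
  set W' : Set {p : Circle × Circle // p.1 ≠ p.2} := Geodesic.mk ⁻¹' Λ with hW'
  have hW'c : IsClosed W' := hΛ.preimage Geodesic.isQuotientMap_mk.continuous
  -- The closure in the compact torus adds only degenerate pairs, and their chords are single points
  -- of the circle. Projecting along a compact factor keeps `F` closed.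
  set K := closure (Subtype.val '' W') with hK
  set F : Set ℂ := Prod.snd '' {q : (Circle × Circle) × ℂ | q.1 ∈ K ∧
    dist (q.1.1 : ℂ) q.2 + dist q.2 (q.1.2 : ℂ) = dist (q.1.1 : ℂ) (q.1.2 : ℂ)} with hF
  have hFc : IsClosed F := by
    refine isClosedMap_snd_of_compactSpace _ (IsClosed.inter ?_ ?_)
    · exact isClosed_closure.preimage continuous_fst
    · exact isClosed_eq (by fun_prop) (by fun_prop)
  have : disc \ leavesUnion Λ = disc \ F := by
    ext x
    refine and_congr_right fun hx => not_congr ?_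
    simp only [leavesUnion, mem_iUnion, exists_prop]
    constructor
    · rintro ⟨g, hg, hxg⟩
      obtain ⟨p, rfl⟩ := g.exists_mk
      exact ⟨(p.1, x), ⟨subset_closure ⟨p, hg, rfl⟩, (mem_openSegment_iff_dist hx).1 hxg⟩, rfl⟩
    · rintro ⟨⟨p, y⟩, ⟨hp, hd⟩, hyx⟩
      obtain rfl : y = x := hyx
      have hseg := (mem_openSegment_iff_dist hx).2 hd
      have hne : p.1 ≠ p.2 := by
        intro h
        rw [h, openSegment_same, mem_singleton_iff] at hseg
        rw [hseg] at hx
        exact (mem_ball_zero_iff.1 hx).ne (Circle.norm_coe _)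
      have hmem : (⟨p, hne⟩ : {p : Circle × Circle // p.1 ≠ p.2}) ∈ closure W' :=
        closure_subtype.2 hp
      rw [hW'c.closure_eq] at hmem
      exact ⟨_, hmem, hseg⟩
  rw [this]
  exact isOpen_disc.sdiff hFc

/-! ### Transverse segments -/

/-- A leaf that meets the line through `x` and `y` twice contains all of that line inside the disc,
hence both `x` and `y`. Transversality thus passes from the segment to its prolongations. -/
theorem IsTransverse.eq_of_lineMap_mem {Λ : Set Geodesic} {x y : ℂ} (h : IsTransverse Λ x y)
    (hx : x ∈ disc) (hy : y ∈ disc) (hxy : x ≠ y) {g : Geodesic} (hg : g ∈ Λ) {u v : ℝ}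
    (hu : AffineMap.lineMap x y u ∈ g.line) (hv : AffineMap.lineMap x y v ∈ g.line) : u = v := by
  by_contra huv
  have key : ∀ r : ℝ, AffineMap.lineMap x y r ∈ disc → AffineMap.lineMap x y r ∈ g.line := by
    intro r hr
    have e : AffineMap.lineMap (AffineMap.lineMap x y u) (AffineMap.lineMap x y v)
        ((r - u) / (v - u)) = AffineMap.lineMap x y r := by
      rw [← AffineMap.apply_lineMap (AffineMap.lineMap x y), AffineMap.lineMap_apply_ring']
      congr 1
      field_simp [sub_ne_zero.2 (Ne.symm huv)]
      ring
    rw [← e] at hr ⊢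
    exact g.lineMap_mem_line hu hv hr
  have h0 := key 0 (by simpa using hx)
  have h1 := key 1 (by simpa using hy)
  simp only [AffineMap.lineMap_apply_zero, AffineMap.lineMap_apply_one] at h0 h1
  exact hxy (h g hg ⟨h0, left_mem_segment ℝ x y⟩ ⟨h1, right_mem_segment ℝ x y⟩)

theorem IsTransverse.lineMap {Λ : Set Geodesic} {x y : ℂ} (h : IsTransverse Λ x y)
    (hx : x ∈ disc) (hy : y ∈ disc) (hxy : x ≠ y) (u v : ℝ) :
    IsTransverse Λ (AffineMap.lineMap x y u) (AffineMap.lineMap x y v) := by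
  rintro g hg p ⟨hp, hps⟩ q ⟨hq, hqs⟩
  rw [segment_eq_image_lineMap] at hps hqs
  obtain ⟨a, -, rfl⟩ := hps
  obtain ⟨b, -, rfl⟩ := hqs
  rw [← AffineMap.apply_lineMap (AffineMap.lineMap x y)] at hp hq ⊢
  rw [← AffineMap.apply_lineMap (AffineMap.lineMap x y)]
  rw [h.eq_of_lineMap_mem hx hy hxy hg hp hq]

/-- Only countably many points of the line through a transverse segment lie on atomic leaves. -/
theorem countable_atoms {μ : Measure Geodesic} [IsLocallyFiniteMeasure μ] {x y : ℂ}
    (h : IsTransverse μ.support x y) (hx : x ∈ disc) (hy : y ∈ disc) (hxy : x ≠ y) :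
    {u : ℝ | 0 < arcMeasure μ {AffineMap.lineMap x y u}}.Countable := by
  simp only [arcMeasure, inter_singleton_nonempty]
  refine Measure.countable_meas_pos_of_disjoint_iUnion₀
    (As := fun u => {g : Geodesic | AffineMap.lineMap x y u ∈ g.line})
    (fun u => (isClosed_setOf_mem_line _).measurableSet.nullMeasurableSet) fun u v huv => ?_
  -- A geodesic through two distinct points of the line is not in the support, so the families for
  -- different `u` are disjoint up to null sets.
  refine measure_mono_null ?_ (Measure.measure_compl_support (μ := μ))
  rintro g ⟨hu, hv⟩ hg
  exact huv (h.eq_of_lineMap_mem hx hy hxy hg hu hv)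

/-- A transverse segment is contained in a slightly longer one whose end points do not lie on
atomic leaves. -/
theorem exists_longer_segment {μ : Measure Geodesic} [IsLocallyFiniteMeasure μ] {x y : ℂ}
    (h : IsTransverse μ.support x y) (hx : x ∈ disc) (hy : y ∈ disc) (hxy : x ≠ y) {c : ℝ}
    (hc : coshDist x y < c) :
    ∃ x' ∈ disc, ∃ y' ∈ disc, IsTransverse μ.support x' y' ∧ arcMeasure μ {x'} = 0 ∧
      arcMeasure μ {y'} = 0 ∧ segment ℝ x y ⊆ segment ℝ x' y' ∧ coshDist x' y' < c := by
  have hc0 : ContinuousAt (fun δ : ℝ => AffineMap.lineMap x y (-δ)) 0 := by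
    simp only [AffineMap.lineMap_apply_module]
    fun_prop
  have hc1 : ContinuousAt (fun δ : ℝ => AffineMap.lineMap x y (1 + δ)) 0 := by
    simp only [AffineMap.lineMap_apply_module]
    fun_prop
  have e0 : AffineMap.lineMap x y (-(0 : ℝ)) = x := by simp
  have e1 : AffineMap.lineMap x y (1 + (0 : ℝ)) = y := by simp
  have hcd : ContinuousAt (fun δ : ℝ =>
      coshDist (AffineMap.lineMap x y (-δ)) (AffineMap.lineMap x y (1 + δ))) 0 := by
    unfold coshDist
    simp only [mink_lift_lift]
    refine ContinuousAt.div ?_ ?_ ?_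
    · fun_prop
    · fun_prop
    · rw [e0, e1]
      have := Real.sqrt_pos.2 (mem_disc_iff.1 hx)
      have := Real.sqrt_pos.2 (mem_disc_iff.1 hy)
      positivity
  have hev : ∀ᶠ δ in 𝓝 (0 : ℝ), AffineMap.lineMap x y (-δ) ∈ disc ∧
      AffineMap.lineMap x y (1 + δ) ∈ disc ∧
      coshDist (AffineMap.lineMap x y (-δ)) (AffineMap.lineMap x y (1 + δ)) < c := by
    refine (hc0.eventually_mem (isOpen_disc.mem_nhds (by rwa [e0]))).and
      ((hc1.eventually_mem (isOpen_disc.mem_nhds (by rwa [e1]))).and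
      (hcd.eventually_lt_const (by beta_reduce; rwa [e0, e1])))
  obtain ⟨ε, hε, hball⟩ := Metric.eventually_nhds_iff.1 hev
  have hB := countable_atoms h hx hy hxy
  have hB' : ({δ : ℝ | 0 < arcMeasure μ {AffineMap.lineMap x y (-δ)}} ∪
      {δ : ℝ | 0 < arcMeasure μ {AffineMap.lineMap x y (1 + δ)}}).Countable :=
    (hB.preimage neg_injective).union (hB.preimage (add_right_injective 1))
  obtain ⟨δ, ⟨hδ0, hδε⟩, hδ⟩ := (hB'.dense_compl ℝ).inter_open_nonempty (Ioo 0 ε) isOpen_Ioo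
    (nonempty_Ioo.2 hε)
  obtain ⟨h1, h2, h3⟩ := hball (y := δ) (by rwa [Real.dist_eq, sub_zero, abs_of_pos hδ0])
  simp only [mem_compl_iff, mem_union, mem_ofPred_eq, not_or, not_lt, nonpos_iff_eq_zero] at hδ
  refine ⟨_, h1, _, h2, h.lineMap hx hy hxy _ _, hδ.1, hδ.2, ?_, h3⟩
  refine (convex_segment _ _).segment_subset ?_ ?_
  · rw [segment_eq_image_lineMap]
    -- The new segment runs over the parameters from `-δ` to `1 + δ`; this is the position of `x`,
    -- parameter `0`, in it. The position of `y` below is found in the same way.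
    refine ⟨δ / (1 + 2 * δ), ⟨by positivity, (div_le_one (by positivity)).2 (by linarith)⟩, ?_⟩
    rw [← AffineMap.apply_lineMap (AffineMap.lineMap x y), AffineMap.lineMap_apply_ring']
    have : δ / (1 + 2 * δ) * (1 + δ - -δ) + -δ = 0 := by
      field_simp
      ring
    rw [this, AffineMap.lineMap_apply_zero]
  · rw [segment_eq_image_lineMap]
    refine ⟨(1 + δ) / (1 + 2 * δ),
      ⟨by positivity, (div_le_one (by positivity)).2 (by linarith)⟩, ?_⟩
    rw [← AffineMap.apply_lineMap (AffineMap.lineMap x y), AffineMap.lineMap_apply_ring']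
    have : (1 + δ) / (1 + 2 * δ) * (1 + δ - -δ) + -δ = 1 := by
      field_simp
      ring
    rw [this, AffineMap.lineMap_apply_one]

/-! ### The Thurston norm of a lamination metered by support planes -/

theorem polygonalInf_le {N : Set (ℂ × Mink)} {x y : ℂ} {v w : Mink} (hv : (x, v) ∈ N)
    (hw : (y, w) ∈ N) : polygonalInf N x y ≤ ENNReal.ofReal √(mink (w - v) (w - v)) := by
  -- The polygon with a single step, from one end point to the other.
  refine iInf_le_of_le 1 <| iInf_le_of_le ![0, 1] <| iInf_le_of_le ![v, w] <| iInf_le_of_le ?_ <|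
    iInf_le_of_le ?_ <| iInf_le_of_le ?_ <| iInf_le_of_le ?_ ?_
  · intro i j hij
    fin_cases i <;> fin_cases j <;> simp_all
  · simp
  · simp
  · intro i
    fin_cases i <;> simp [hv, hw]
  · simp

theorem one_sub_tanh_one_nonneg : 0 ≤ 1 - Real.tanh 1 := by
  linarith [Real.tanh_lt_one 1]

theorem one_sub_tanh_one_le : (1 - Real.tanh 1) / (2 * √2) ≤ 1 / 8 := by
  have he := Real.exp_one_gt_d9
  have hm : Real.exp (-1) = (Real.exp 1)⁻¹ := Real.exp_neg 1
  have h1 : 2 / 3 ≤ Real.tanh 1 := by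
    rw [Real.tanh_eq_sinh_div_cosh, Real.sinh_eq, Real.cosh_eq, hm,
      div_div_div_cancel_right₀ two_ne_zero, le_div_iff₀ (by positivity)]
    have : (Real.exp 1)⁻¹ ≤ (2.7 : ℝ)⁻¹ := inv_anti₀ (by norm_num) (by linarith)
    norm_num at this
    linarith
  have h2 : 4 / 3 ≤ √2 := Real.le_sqrt_of_sq_le (by norm_num)
  rw [div_le_div_iff₀ (by positivity) (by norm_num)]
  linarith

theorem cosh_one_lt_two : Real.cosh 1 < 2 := by
  have he := Real.exp_one_gt_d9
  have he' := Real.exp_one_lt_d9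
  have : (Real.exp 1)⁻¹ ≤ (2.7 : ℝ)⁻¹ := inv_anti₀ (by norm_num) (by linarith)
  norm_num at this
  rw [Real.cosh_eq, Real.exp_neg]
  linarith

/-- A measured lamination which is metered by support planes of the hull has a Thurston norm bounded
by the width. -/
theorem mul_thurstonNorm_le_width {X : Circle → ℂ} (hXc : Continuous X) (s : Side)
    {μ : Measure Geodesic} (hμ : IsMeasuredLamination μ) {N : Set (ℂ × Mink)}
    (hN : ∀ p ∈ N, p.1 ∈ disc → p ∈ normalBundle s X) (hN' : ∀ x ∈ disc, ∃ v, (x, v) ∈ N)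
    (hμN : IsMeteredBy μ N) :
    ENNReal.ofReal ((1 - Real.tanh 1) / (2 * √2)) * thurstonNorm μ ≤ width X := by
  have := hμ.1
  set κ := (1 - Real.tanh 1) / (2 * √2) with hκ
  have hκ0 : 0 ≤ κ := div_nonneg one_sub_tanh_one_nonneg (by positivity)
  have hκ8 : κ ≤ 1 / 8 := one_sub_tanh_one_le
  simp only [thurstonNorm, ENNReal.mul_iSup]
  refine iSup_le fun x => iSup_le fun y => iSup_le fun hx => iSup_le fun hy => iSup_le fun hxy =>
    iSup_le fun hT => ?_
  have hne : x ≠ y := by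
    rintro rfl
    have h1 := coshDist_eq_of_hypDist_eq hx hx hxy
    have h2 := coshDist_sq_mul hx hx
    have h3 := mem_disc_iff.1 hx
    rw [← mink_lift_self] at h2 h3
    have h4 : (coshDist x x ^ 2 - 1) * mink (lift x) (lift x) ^ 2 = 0 := by linear_combination h2
    have h5 : 1 < coshDist x x := h1 ▸ Real.one_lt_cosh.2 one_ne_zero
    have h6 : 0 < coshDist x x ^ 2 - 1 := by nlinarith
    have h7 : 0 < mink (lift x) (lift x) ^ 2 := by nlinarith
    exact (mul_pos h6 h7).ne' h4
  -- Metering says nothing about segments that end on atomic leaves, so the segment is prolonged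
  -- slightly. The bound `cosh d < 2` leaves room, since `cosh 1 < 2`.
  obtain ⟨x', hx', y', hy', hT', hx0, hy0, hsub, hc⟩ := exists_longer_segment hT hx hy hne
    (c := 2) (by rw [coshDist_eq_of_hypDist_eq hx hy hxy]; exact cosh_one_lt_two)
  obtain ⟨v, hv⟩ := hN' x' hx'
  obtain ⟨w, hw⟩ := hN' y' hy'
  have hc1 := one_le_coshDist hx' hy'
  calc ENNReal.ofReal κ * arcMeasure μ (segment ℝ x y)
      ≤ ENNReal.ofReal κ * arcMeasure μ (segment ℝ x' y') := by
        gcongr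
        exact measure_mono fun g hg => hg.mono (inter_subset_inter_right _ hsub)
    _ = ENNReal.ofReal κ * polygonalInf N x' y' := by rw [hμN x' hx' y' hy' hT' hx0 hy0]
    _ ≤ ENNReal.ofReal κ * ENNReal.ofReal √(mink (w - v) (w - v)) := by
        gcongr
        exact polygonalInf_le hv hw
    _ = ENNReal.ofReal (κ * √(mink (w - v) (w - v))) := (ENNReal.ofReal_mul hκ0).symm
    -- With `S = 7/4`, `cosh² d - 1 < 3 ≤ 49/16 = S²`, and `κ ≤ 1/8` gives `4κS + 4κ² ≤ 15/16`.
    _ ≤ width X := ofReal_mul_sqrt_le_width_of_mem_normalBundle hXc s hκ0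
        (by norm_num : (0 : ℝ) ≤ 7 / 4) (by nlinarith) (by nlinarith) (hN _ hv hx') (hN _ hw hy')

/-! ### Strata of infinitesimal earthquakes -/

/-- The sign `1` for left and `-1` for right. -/
def Side.sign : Side → ℝ
  | .left => 1
  | .right => -1

theorem Side.sign_mul_pos {s : Side} {d : ℝ} (h : s.HasSign d) : 0 < s.sign * d := by
  cases s <;> simpa [Side.sign, Side.HasSign] using h

theorem Side.sign_mul_self (s : Side) : s.sign * s.sign = 1 := by
  cases s <;> simp [Side.sign]

theorem mem_normalBundle_iff {s : Side} {X : Circle → ℂ} {x : ℂ} {v : Mink} :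
    (x, v) ∈ normalBundle s X ↔ x ∈ disc ∧ (x, mink (lift x) v) ∈ hull X ∧
      ∀ z : Circle, s.sign * mink (lift z) v ≤ s.sign * supportFun X z := by
  cases s with
  | left =>
    simp only [Side.sign, one_mul]
    refine ⟨fun h => ⟨h.1.2.1, h.1.1, fun z => h.2 _ (graph_mem_hull X z)⟩, fun h =>
      ⟨⟨h.2.1, h.1, fun t ht => mink_le_of_mem_hull h.2.2 ht⟩,
        fun q hq => mink_le_of_mem_hull h.2.2 hq⟩⟩
  | right =>
    simp only [Side.sign, neg_mul, one_mul, neg_le_neg_iff]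
    refine ⟨fun h => ⟨h.1.2.1, h.1.1, fun z => h.2 _ (graph_mem_hull X z)⟩, fun h =>
      ⟨⟨h.2.1, h.1, fun t ht => le_mink_of_mem_hull h.2.2 ht⟩,
        fun q hq => le_mink_of_mem_hull h.2.2 hq⟩⟩

theorem killing_re (σ : Mink) (η : ℂ) : (killing σ η).re =
    η.im * σ 0 - σ 2 + (η.re * σ 2 - η.im * σ 1) * η.re := by
  simp [killing, box, lift]
  ring

theorem killing_im (σ : Mink) (η : ℂ) : (killing σ η).im =
    σ 1 - η.re * σ 0 + (η.re * σ 2 - η.im * σ 1) * η.im := by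
  simp [killing, box, lift]
  ring

theorem killing_sub (σ τ : Mink) (η : ℂ) : killing (τ - σ) η = killing τ η - killing σ η := by
  apply Complex.ext
  · simp only [Complex.sub_re, killing_re, Pi.sub_apply]
    ring
  · simp only [Complex.sub_im, killing_im, Pi.sub_apply]
    ring

@[fun_prop]
theorem continuous_killing (σ : Mink) : Continuous (killing σ) := by
  have : killing σ = fun η => ((killing σ η).re : ℂ) + (killing σ η).im * Complex.I := by
    ext η
    exact (Complex.re_add_im _).symm
  rw [this]
  simp only [killing_re, killing_im]
  fun_prop

/-- Translating to the left across the axis means that the affine function of `a` increases along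
the arc. This turns the orientation condition on earthquakes into an order of affine functions. -/
theorem planeDet_killing {a : Mink} {p : ℂ} (hp : mink (lift p) a = 0) (x y : ℂ) :
    planeDet (y - x) (killing a p) = (1 - ‖p‖ ^ 2) * (mink (lift y) a - mink (lift x) a) := by
  rw [mink_lift] at hp
  rw [norm_sq_eq_re_im]
  simp only [planeDet, killing_re, killing_im, mink_lift, Complex.sub_re, Complex.sub_im]
  linear_combination ((y.re - x.re) * p.re + (y.im - x.im) * p.im) * hp

theorem exists_segment_inter_axis {a : Mink} {x y : ℂ} (hx : x ∈ disc) (hy : y ∈ disc)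
    (hne : mink (lift x) a ≠ mink (lift y) a) (hle : mink (lift x) a * mink (lift y) a ≤ 0) :
    ∃ p ∈ disc, mink (lift p) a = 0 ∧ segment ℝ x y ∩ axis a = {p} := by
  set b := mink (lift x) a with hb
  set c := mink (lift y) a with hc
  have hl : ∀ u : ℝ, mink (lift (AffineMap.lineMap x y u)) a = b + u * (c - b) := by
    intro u
    rw [AffineMap.lineMap_apply_module, mink_lift_combo (by ring)]
    ring
  have hd : b - c ≠ 0 := sub_ne_zero.2 hne
  have hd2 : 0 < (b - c) ^ 2 := by positivity
  have hu0 : 0 ≤ b / (b - c) := by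
    rw [show b / (b - c) = (b ^ 2 - b * c) / (b - c) ^ 2 by field_simp]
    exact div_nonneg (by nlinarith [sq_nonneg b]) hd2.le
  have hu1 : b / (b - c) ≤ 1 := by
    rw [show b / (b - c) = (b ^ 2 - b * c) / (b - c) ^ 2 by field_simp, div_le_one hd2]
    nlinarith [sq_nonneg c]
  have hseg : AffineMap.lineMap x y (b / (b - c)) ∈ segment ℝ x y := by
    rw [segment_eq_image_lineMap]
    exact ⟨_, ⟨hu0, hu1⟩, rfl⟩
  have hpd := convex_disc.segment_subset hx hy hseg
  have hp0 : mink (lift (AffineMap.lineMap x y (b / (b - c)))) a = 0 := by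
    rw [hl]
    field_simp
    ring
  refine ⟨_, hpd, hp0, Subset.antisymm ?_ (singleton_subset_iff.2 ⟨hseg, hpd, hp0⟩)⟩
  rintro q ⟨hq, -, hq0⟩
  rw [segment_eq_image_lineMap] at hq
  obtain ⟨u, -, rfl⟩ := hq
  rw [hl] at hq0
  have : u = b / (b - c) := by
    rw [eq_div_iff hd]
    linarith
  rw [this, mem_singleton_iff]

theorem IsStratum.subset_disc {Λ : Set Geodesic} {S : Set ℂ} (h : IsStratum Λ S) : S ⊆ disc := by
  rcases h with ⟨g, -, rfl⟩ | ⟨x, -, rfl⟩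
  · exact g.line_subset_disc
  · exact (connectedComponentIn_subset _ _).trans sdiff_subset

theorem exists_isStratum (Λ : Set Geodesic) {x : ℂ} (hx : x ∈ disc) :
    ∃ S, IsStratum Λ S ∧ x ∈ S := by
  by_cases h : x ∈ leavesUnion Λ
  · simp only [leavesUnion, mem_iUnion, exists_prop] at h
    obtain ⟨g, hg, hxg⟩ := h
    exact ⟨_, Or.inl ⟨g, hg, rfl⟩, hxg⟩
  · exact ⟨_, Or.inr ⟨x, ⟨hx, h⟩, rfl⟩, mem_connectedComponentIn ⟨hx, h⟩⟩

/-- The affine functions of the Killing fields of an infinitesimal earthquake are ordered. -/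
theorem IsInfEarthquake.sign_mul_mink {s : Side} {Λ : Set Geodesic} {E : ℂ → ℂ}
    (hE : IsInfEarthquake s Λ E) {S T : Set ℂ} (hS : IsStratum Λ S) (hT : IsStratum Λ T)
    {σ τ : Mink} (hσ : AgreesOn E S σ) (hτ : AgreesOn E T τ) {x y : ℂ} (hx : x ∈ S) (hy : y ∈ T) :
    s.sign * mink (lift x) (τ - σ) ≤ 0 ∧ 0 ≤ s.sign * mink (lift y) (τ - σ) := by
  by_cases h0 : τ - σ = 0
  · simp [h0, mink_lift]
  obtain ⟨-, hsep, htr⟩ := (hE.2.2 S T hS hT σ τ hσ hτ).2 h0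
  set b := mink (lift x) (τ - σ) with hb
  set c := mink (lift y) (τ - σ) with hc
  have hcases : (b ≤ 0 ∧ 0 ≤ c) ∨ (0 ≤ b ∧ c ≤ 0) :=
    hsep.imp (fun h => ⟨h.1 x hx, h.2 y hy⟩) (fun h => ⟨h.1 x hx, h.2 y hy⟩)
  -- If the values agree, weak separation makes both zero. Otherwise the arc crosses the axis once
  -- and the translation condition decides between the two signs.
  by_cases hbc : b = c
  · have : b = 0 := by
      rcases hcases with h | h <;> linarith [h.1, h.2]
    rw [← hbc, this, mul_zero]
    exact ⟨le_rfl, le_rfl⟩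
  obtain ⟨p, hp, hp0, hpa⟩ := exists_segment_inter_axis (hS.subset_disc hx) (hT.subset_disc hy) hbc
    (by rcases hcases with h | h <;> nlinarith [h.1, h.2])
  have hsign := Side.sign_mul_pos (htr x hx y hy p hpa)
  rw [planeDet_killing hp0, ← hb, ← hc, mul_left_comm,
    mul_pos_iff_of_pos_left (mem_disc_iff.1 hp)] at hsign
  cases s <;> simp only [Side.sign, one_mul, neg_mul] at hsign ⊢ <;>
    rcases hcases with h | h <;> constructor <;> linarith [h.1, h.2]

/-- On the circle the last term vanishes and the Killing field has the affine function of `ρ` as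
support function. Inside the disc the term `ρ 0` remains, with no uniform bound over the strata;
`le_killing_tangential` avoids it. -/
theorem killing_tangential (ρ : Mink) (η : ℂ) :
    η.re * (killing ρ η).im - η.im * (killing ρ η).re
      = mink (lift η) ρ + (1 - ‖η‖ ^ 2) * ρ 0 := by
  rw [norm_sq_eq_re_im, killing_re, killing_im, mink_lift]
  ring

/-- An estimate from below of the tangential part of a Killing field. -/
theorem le_killing_tangential {ρ : Mink} {ε : ℝ} {η ξ : ℂ} (hη : η ∈ disc) (hξ : ξ ∈ disc)
    (h0 : 0 ≤ ε * mink (lift η) ρ) (h1 : ε * mink (lift ξ) ρ ≤ 0) :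
    (ξ.re * η.re + ξ.im * η.im) * (1 - ‖η‖ ^ 2) *
        (ε * (η.re * (killing ρ η).im - η.im * (killing ρ η).re))
      - (ξ.im * η.re - ξ.re * η.im) *
        (ε * (η.re * (killing ρ η).re + η.im * (killing ρ η).im))
      ≤ ε * (η.re * (killing ρ η).im - η.im * (killing ρ η).re) * ‖η‖ ^ 2 *
        (1 - (ξ.re * η.re + ξ.im * η.im)) := by
  have hη' := mem_disc_iff.1 hη
  have hin : 0 ≤ 1 - (ξ.re * η.re + ξ.im * η.im) := by
    have a1 := mem_disc_iff_re_im.1 hη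
    have a2 := mem_disc_iff_re_im.1 hξ
    nlinarith [sq_nonneg (ξ.re - η.re), sq_nonneg (ξ.im - η.im)]
  -- The value at `ξ` of the affine function is expressed by its value at `η` and the tangential and
  -- radial parts of the field at `η`, so no coordinate of `ρ` survives in the estimate.
  have e : ε * (η.re * (killing ρ η).im - η.im * (killing ρ η).re) * ‖η‖ ^ 2 *
        (1 - (ξ.re * η.re + ξ.im * η.im))
      - ((ξ.re * η.re + ξ.im * η.im) * (1 - ‖η‖ ^ 2) *
        (ε * (η.re * (killing ρ η).im - η.im * (killing ρ η).re))
      - (ξ.im * η.re - ξ.re * η.im) *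
        (ε * (η.re * (killing ρ η).re + η.im * (killing ρ η).im)))
      = ε * mink (lift η) ρ * (‖η‖ ^ 2 * (1 - (ξ.re * η.re + ξ.im * η.im)))
        + -(ε * mink (lift ξ) ρ) * ((1 - ‖η‖ ^ 2) * ‖η‖ ^ 2) := by
    rw [norm_sq_eq_re_im, killing_re, killing_im, mink_lift, mink_lift]
    ring
  have p1 : 0 ≤ ε * mink (lift η) ρ * (‖η‖ ^ 2 * (1 - (ξ.re * η.re + ξ.im * η.im))) := by positivity
  have p2 : 0 ≤ -(ε * mink (lift ξ) ρ) * ((1 - ‖η‖ ^ 2) * ‖η‖ ^ 2) :=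
    mul_nonneg (neg_nonneg.2 h1) (by positivity)
  linarith

theorem supportFun_eq_of_eq_killing {X : Circle → ℂ} (hX : IsCircleField X) {z : Circle} {σ : Mink}
    (h : X z = killing σ z) : supportFun X z = mink (lift z) σ := by
  have h1 := killing_tangential σ z
  rw [Circle.norm_coe, ← h, eq_supportFun hX] at h1
  simp only [Complex.mul_re, Complex.mul_im, Complex.I_re, Complex.I_im, Complex.ofReal_re,
    Complex.ofReal_im] at h1
  linear_combination h1 - supportFun X z * circle_re_im z

/-- At the ideal boundary points of a stratum, `φ_X` agrees with the affine function of the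
stratum. -/
theorem supportFun_eq_of_mem_closure {X : Circle → ℂ} (hX : IsCircleField X) {E : ℂ → ℂ}
    (hEX : ExtendsTo E X) {S : Set ℂ} (hSd : S ⊆ disc) {σ : Mink} (hσ : AgreesOn E S σ) {z : Circle}
    (hz : (z : ℂ) ∈ closure S) : supportFun X z = mink (lift z) σ := by
  have : (𝓝[S] (z : ℂ)).NeBot := mem_closure_iff_nhdsWithin_neBot.1 hz
  refine supportFun_eq_of_eq_killing hX (tendsto_nhds_unique
    ((hEX z).mono_left (nhdsWithin_mono _ hSd)) ?_)
  refine (((continuous_killing σ).tendsto z).mono_left nhdsWithin_le_nhds).congr' ?_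
  filter_upwards [self_mem_nhdsWithin] with η hη
  exact (hσ η hη).symm

theorem circle_mem_closure_disc (z : Circle) : (z : ℂ) ∈ closure disc := by
  rw [disc, closure_ball _ one_ne_zero, mem_closedBall_zero_iff, Circle.norm_coe]

/-- The affine function of a stratum of an infinitesimal earthquake bounds `φ_X`. -/
theorem IsInfEarthquake.sign_mul_mink_le {X : Circle → ℂ} (hX : IsCircleField X) {s : Side}
    {Λ : Set Geodesic} {E : ℂ → ℂ} (hE : IsInfEarthquake s Λ E) (hEX : ExtendsTo E X) {S : Set ℂ}
    (hS : IsStratum Λ S) {σ : Mink} (hσ : AgreesOn E S σ) {ξ : ℂ} (hξ : ξ ∈ S) (z : Circle) :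
    s.sign * mink (lift z) σ ≤ s.sign * supportFun X z := by
  have hne : (𝓝[disc] (z : ℂ)).NeBot :=
    mem_closure_iff_nhdsWithin_neBot.1 (circle_mem_closure_disc z)
  have hξd := hS.subset_disc hξ
  set F : ℂ → ℂ := fun η => E η - killing σ η with hF
  have hFz : Tendsto F (𝓝[disc] (z : ℂ)) (𝓝 (X z - killing σ z)) :=
    (hEX z).sub (((continuous_killing σ).tendsto _).mono_left nhdsWithin_le_nhds)
  have hid : Tendsto (fun η : ℂ => η) (𝓝[disc] (z : ℂ)) (𝓝 (z : ℂ)) :=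
    tendsto_id.mono_left nhdsWithin_le_nhds
  have hre := (Complex.continuous_re.tendsto _).comp hFz
  have him := (Complex.continuous_im.tendsto _).comp hFz
  have hidre := (Complex.continuous_re.tendsto _).comp hid
  have hidim := (Complex.continuous_im.tendsto _).comp hid
  have hnorm := (hid.norm).pow 2
  have hA := ((hidre.mul him).sub (hidim.mul hre)).const_mul s.sign
  have hB := ((hidre.mul hre).add (hidim.mul him)).const_mul s.sign
  have hdot := (hidre.const_mul ξ.re).add (hidim.const_mul ξ.im)
  have hcross := (hidre.const_mul ξ.im).sub (hidim.const_mul ξ.re)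
  -- The vector `τ` of the stratum of `η` need not converge as `η → z`, but the estimate involves
  -- only the difference field `F`, which does. The left side tends to `0`: `1 - ‖η‖²` vanishes in
  -- the limit, and so does the radial part of `F`.
  have hlim := le_of_tendsto_of_tendsto
    (((hdot.mul (hnorm.const_sub 1)).mul hA).sub (hcross.mul hB))
    ((hA.mul hnorm).mul (hdot.const_sub 1)) (by
      filter_upwards [self_mem_nhdsWithin] with η hη
      obtain ⟨T, hT, hηT⟩ := exists_isStratum Λ hη
      obtain ⟨τ, hτ⟩ := hE.2.1 T hT
      obtain ⟨h1, h0⟩ := hE.sign_mul_mink hS hT hσ hτ hξ hηT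
      have h := le_killing_tangential hη hξd h0 h1
      rw [killing_sub, ← hτ η hηT] at h
      exact h)
  have hz := circle_re_im z
  have hX1 : (z : ℂ).re * (X z - killing σ z).im - (z : ℂ).im * (X z - killing σ z).re
      = supportFun X z - mink (lift z) σ := by
    have h1 := killing_tangential σ z
    rw [Circle.norm_coe] at h1
    rw [eq_supportFun hX]
    simp only [Complex.sub_re, Complex.sub_im, Complex.mul_re, Complex.mul_im, Complex.I_re,
      Complex.I_im, Complex.ofReal_re, Complex.ofReal_im]
    linear_combination supportFun X z * hz - h1
  have hX2 : (z : ℂ).re * (X z - killing σ z).re + (z : ℂ).im * (X z - killing σ z).im = 0 := by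
    rw [eq_supportFun hX]
    simp only [Complex.sub_re, Complex.sub_im, Complex.mul_re, Complex.mul_im, Complex.I_re,
      Complex.I_im, Complex.ofReal_re, Complex.ofReal_im, killing_re, killing_im]
    linear_combination -((z : ℂ).re * σ 2 - (z : ℂ).im * σ 1) * hz
  rw [hX1, hX2, Circle.norm_coe] at hlim
  have hin : 0 < 1 - (ξ.re * (z : ℂ).re + ξ.im * (z : ℂ).im) := by
    have := mem_disc_iff_re_im.1 hξd
    nlinarith [sq_nonneg (ξ.re - (z : ℂ).re), sq_nonneg (ξ.im - (z : ℂ).im)]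
  have hfin : 0 ≤ s.sign * (supportFun X z - mink (lift z) σ) := by
    refine nonneg_of_mul_nonneg_left ?_ hin
    simpa using hlim
  linarith

theorem segment_eq_closure_line (p : {p : Circle × Circle // p.1 ≠ p.2}) :
    segment ℝ (p.1.1 : ℂ) (p.1.2 : ℂ) = closure (Geodesic.mk p).line := by
  rw [Geodesic.line_mk, closure_openSegment]

/-- The affine functions of the strata of an infinitesimal earthquake are support planes of the
hull. -/
theorem IsInfEarthquake.mem_normalBundle {X : Circle → ℂ} (hX : IsCircleField X)
    (hXc : Continuous X) {s : Side} {Λ : Set Geodesic} {E : ℂ → ℂ} (hE : IsInfEarthquake s Λ E)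
    (hEX : ExtendsTo E X) {S : Set ℂ} (hS : IsStratum Λ S) {σ : Mink} (hσ : AgreesOn E S σ) {x : ℂ}
    (hx : x ∈ S) : (x, σ) ∈ normalBundle s X := by
  have hxd := hS.subset_disc hx
  have hle := hE.sign_mul_mink_le hX hEX hS hσ hx
  refine mem_normalBundle_iff.2 ⟨hxd, ?_, hle⟩
  rcases hS with ⟨g, hg, rfl⟩ | ⟨y, hy, hSy⟩
  -- Over a leaf, both ideal end points are contact points, and their chord in the hull lies on the
  -- plane of `σ`.
  · have hS : IsStratum Λ g.line := Or.inl ⟨g, hg, rfl⟩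
    obtain ⟨p, rfl⟩ := g.exists_mk
    have ha := supportFun_eq_of_mem_closure hX hEX hS.subset_disc hσ (z := p.1.1)
      (segment_eq_closure_line p ▸ left_mem_segment ℝ _ _)
    have hb := supportFun_eq_of_mem_closure hX hEX hS.subset_disc hσ (z := p.1.2)
      (segment_eq_closure_line p ▸ right_mem_segment ℝ _ _)
    obtain ⟨α, β, hα, hβ, hαβ, rfl⟩ := hx
    rw [mink_lift_combo hαβ, ← ha, ← hb]
    exact chord_mem_hull X _ _ hα.le hβ.le hαβ
  have hS : IsStratum Λ S := Or.inr ⟨y, hy, hSy⟩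
  have hU := isOpen_disc_diff_leavesUnion hE.1.1
  have hSo : IsOpen S := hSy ▸ hU.connectedComponentIn
  -- Over a gap, compare with a true support plane `v` at `x`. If it differed from `σ` at `x`, then
  -- `v` would be strictly on the hull's side of `σ` in a half-plane `H` around `x`. This half-plane
  -- must leave the gap at a frontier point `p`, where contact of `σ` with the hull gives a
  -- contradiction.
  obtain ⟨v, hv⟩ := exists_mem_normalBundle hXc s hxd
  obtain ⟨-, hvx, hvle⟩ := mem_normalBundle_iff.1 hv
  suffices h : mink (lift x) σ = mink (lift x) v by rwa [h]
  by_contra hne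
  have hpos : 0 < s.sign * mink (lift x) (v - σ) := by
    rw [mink_lift_sub]
    cases s with
    | left =>
      simp only [Side.sign, one_mul] at hle ⊢
      exact sub_pos.2 (lt_of_le_of_ne (mink_le_of_mem_hull hle hvx) hne)
    | right =>
      simp only [Side.sign, neg_mul, one_mul, neg_le_neg_iff] at hle ⊢
      have := lt_of_le_of_ne (le_mink_of_mem_hull hle hvx) (Ne.symm hne)
      simp only at this
      linarith
  set H : Set ℂ := {q | 0 < s.sign * mink (lift q) (v - σ)} with hH
  have hHc : Convex ℝ H := by
    intro q hq r hr a b ha hb hab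
    simp only [hH, mem_ofPred_eq] at hq hr ⊢
    rw [mink_lift_combo hab, mul_add, mul_left_comm, mul_left_comm s.sign]
    rcases ha.eq_or_lt with rfl | ha
    · obtain rfl : b = 1 := by linarith
      simpa using hr
    · have := mul_pos ha hq
      have := mul_nonneg hb hr.le
      linarith
  have hout : (H ∩ Sᶜ).Nonempty := by
    -- Both `x + 2` and `x - 2` are outside the disc, and an affine function positive at their
    -- midpoint `x` is positive at one of them.
    have hfar : ∀ e : ℝ, e ^ 2 = 4 → x + (e : ℂ) ∉ S := by
      intro e he hmem
      have h1 := mem_disc_iff_re_im.1 hxd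
      have h2 := mem_disc_iff_re_im.1 (hS.subset_disc hmem)
      simp only [Complex.add_re, Complex.ofReal_re, Complex.add_im, Complex.ofReal_im,
        add_zero] at h2
      nlinarith [sq_nonneg (2 * x.re + e), sq_nonneg x.im]
    have hsum : s.sign * mink (lift (x + ((2 : ℝ) : ℂ))) (v - σ)
        + s.sign * mink (lift (x + ((-2 : ℝ) : ℂ))) (v - σ)
        = 2 * (s.sign * mink (lift x) (v - σ)) := by
      simp only [mink_lift, Complex.add_re, Complex.ofReal_re, Complex.add_im, Complex.ofReal_im]
      ring
    by_cases h2 : 0 < s.sign * mink (lift (x + ((2 : ℝ) : ℂ))) (v - σ)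
    · exact ⟨_, h2, hfar 2 (by norm_num)⟩
    · refine ⟨x + ((-2 : ℝ) : ℂ), ?_, hfar (-2) (by norm_num)⟩
      simp only [hH, mem_ofPred_eq]
      linarith
  obtain ⟨p, hpH, hpcl, hpS⟩ : ∃ p ∈ H, p ∈ closure S ∧ p ∉ S := by
    by_contra! hno
    obtain ⟨q, hqH, hqS⟩ := hout
    obtain ⟨r, -, hr, hr'⟩ := hHc.isPreconnected S (closure S)ᶜ hSo isClosed_closure.isOpen_compl
      (fun r hr => (em (r ∈ closure S)).imp (hno r hr) id) ⟨x, hpos, hx⟩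
      ⟨q, hqH, fun h => hqS (hno q hqH h)⟩
    exact hr' (subset_closure hr)
  simp only [hH, mem_ofPred_eq] at hpH
  have hcontact : ∀ z : Circle, supportFun X z = mink (lift z) σ →
      s.sign * mink (lift z) (v - σ) ≤ 0 := by
    intro z hz
    rw [mink_lift_sub, mul_sub, ← hz]
    linarith [hvle z]
  by_cases hpd : p ∈ disc
  swap
  · have hp1 : ‖p‖ = 1 := by
      refine le_antisymm ?_ (not_lt.1 fun h => hpd (mem_ball_zero_iff.2 h))
      have := closure_mono hS.subset_disc hpcl
      rwa [disc, closure_ball _ one_ne_zero, mem_closedBall_zero_iff] at this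
    have := hcontact ⟨p, mem_sphere_zero_iff_norm.2 hp1⟩
      (supportFun_eq_of_mem_closure hX hEX hS.subset_disc hσ hpcl)
    exact absurd hpH (not_lt.2 this)
  -- Were `p` off the leaves, its open component would meet the gap and so equal it, putting `p` in
  -- the gap.
  have hpl : p ∈ leavesUnion Λ := by
    by_contra hpl
    have hpU : p ∈ disc \ leavesUnion Λ := ⟨hpd, hpl⟩
    obtain ⟨q, hq1, hq2⟩ := mem_closure_iff.1 hpcl _ hU.connectedComponentIn
      (mem_connectedComponentIn hpU)
    rw [hSy] at hq2
    have := (connectedComponentIn_eq hq1).trans (connectedComponentIn_eq hq2).symm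
    exact hpS (hSy ▸ this ▸ mem_connectedComponentIn hpU)
  simp only [leavesUnion, mem_iUnion, exists_prop] at hpl
  obtain ⟨g, hg, hpg⟩ := hpl
  have hT : IsStratum Λ g.line := Or.inl ⟨g, hg, rfl⟩
  obtain ⟨τ, hτ⟩ := hE.2.1 _ hT
  have hp0 : s.sign * mink (lift p) (τ - σ) ≤ 0 :=
    closure_minimal (t := {q | s.sign * mink (lift q) (τ - σ) ≤ 0})
      (fun q hq => (hE.sign_mul_mink hS hT hσ hτ hq hpg).1)
      (isClosed_le (by fun_prop) continuous_const) hpcl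
  have hcl : ∀ q ∈ closure g.line, 0 ≤ s.sign * mink (lift q) (τ - σ) := fun q hq =>
    closure_minimal (t := {q | 0 ≤ s.sign * mink (lift q) (τ - σ)})
      (fun q hq => (hE.sign_mul_mink hS hT hσ hτ hx hq).2)
      (isClosed_le continuous_const (by fun_prop)) hq
  obtain ⟨e, rfl⟩ := g.exists_mk
  have hacl : (e.1.1 : ℂ) ∈ closure (Geodesic.mk e).line :=
    segment_eq_closure_line e ▸ left_mem_segment ℝ _ _
  have hbcl : (e.1.2 : ℂ) ∈ closure (Geodesic.mk e).line :=
    segment_eq_closure_line e ▸ right_mem_segment ℝ _ _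
  have ha0 := hcl _ hacl
  have hb0 := hcl _ hbcl
  obtain ⟨α, β, hα, hβ, hαβ, rfl⟩ := hpg
  rw [mink_lift_combo hαβ, mul_add, mul_left_comm, mul_left_comm s.sign] at hp0 hpH
  have hvanish : ∀ d : ℝ, s.sign * d = 0 → d = 0 := fun d hd => by
    rw [← one_mul d, ← s.sign_mul_self, mul_assoc, hd, mul_zero]
  -- The signed difference is nonnegative at both ends of the leaf and nonpositive at its interior
  -- point `p`, so it vanishes at the ends. These are then contact points for `σ` as well as for
  -- `τ`.
  have ha1 : mink (lift e.1.1) (τ - σ) = 0 := 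
    hvanish _ (by nlinarith [mul_nonneg hα.le ha0, mul_nonneg hβ.le hb0])
  have hb1 : mink (lift e.1.2) (τ - σ) = 0 := 
    hvanish _ (by nlinarith [mul_nonneg hα.le ha0, mul_nonneg hβ.le hb0])
  rw [mink_lift_sub, sub_eq_zero] at ha1 hb1
  have ha2 := hcontact e.1.1
    ((supportFun_eq_of_mem_closure hX hEX hT.subset_disc hτ hacl).trans ha1)
  have hb2 := hcontact e.1.2
    ((supportFun_eq_of_mem_closure hX hEX hT.subset_disc hτ hbcl).trans hb1)
  nlinarith

end HalfPipe
end

theorem theorem1p3 (X : Circle → ℂ) (hX : HalfPipe.IsCircleField X) (hXc : Continuous X) :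
    (∀ (s : HalfPipe.Side) (E : ℂ → ℂ) (μ : Measure HalfPipe.Geodesic),
      HalfPipe.IsMeasuredLamination μ →
      HalfPipe.IsInfEarthquake s μ.support E →
      HalfPipe.ExtendsTo E X →
      HalfPipe.IsBendingMeasure s X μ ∨ HalfPipe.IsShearingMeasure E μ →
      ENNReal.ofReal ((1 - Real.tanh 1) / (2 * √2)) * HalfPipe.thurstonNorm μ
        ≤ HalfPipe.width X) ∧
    HalfPipe.width X ≤ ENNReal.ofReal (8 / 3) * HalfPipe.crossRatioNorm X ∧
    (HalfPipe.IsZygmund X ↔ HalfPipe.width X < ⊤) := by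
  refine ⟨fun s E μ hμ hE hEX hor => ?_, HalfPipe.width_le hX hXc, HalfPipe.isZygmund_iff hX hXc⟩
  -- In both descriptions the metering pairs are support planes and there is one over every point of
  -- the disc, which is all that the estimate requires.
  rcases hor with h | h
  · exact HalfPipe.mul_thurstonNorm_le_width hXc s hμ (fun p hp _ => hp)
      (fun x hx => HalfPipe.exists_mem_normalBundle hXc s hx) h
  · refine HalfPipe.mul_thurstonNorm_le_width hXc s hμ ?_ ?_ h
    · rintro ⟨x, σ⟩ ⟨S, hS, hx, hσ⟩ -
      exact hE.mem_normalBundle hX hXc hEX hS hσ hx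
    · intro x hx
      obtain ⟨S, hS, hxS⟩ := HalfPipe.exists_isStratum μ.support hx
      obtain ⟨σ, hσ⟩ := hE.2.1 S hS
      exact ⟨σ, S, hS, hxS, hσ⟩
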